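/- **Annealed CLT for $\mathrm{CM}_N(\mathbf 1,\mathbf 2)$.** Let $p\in(0,1)$, $\beta>0$ and $B\in\mathbb R$. For each $N$ let $d=(d_i)_{i\in[N]}$ be a degree sequence with $n_2=\lfloor pN\rfloor$ entries equal to $2$ and $n_1=N-\lfloor pN\rfloor$ entries equal to $1$, and let $N$ range over the integers for which the total degree $N+\lfloor pN\rfloor$ is even. Let $Q_N$ be the law of the configuration model with these degrees, i.e. of the random multigraph on $[N]$ obtained from a uniformly random pairing of the half-edges ($d_i$ half-edges at vertex $i$). For $\sigma\in\{-1,1\}^N$ put $S_N=\sum_i\sigma_i$, let $Z_N(\beta,B)=\sum_\sigma \exp\big[\beta\sum_{(i,j)\in E_N}\sigma_i\sigma_j+B\sum_i\sigma_i\big]$ (edges counted with multiplicity, self-loops included), and let $\widetilde P_N$ be the annealed measure $$\widetilde P_N(\sigma)=\frac{Q_N\big(\exp[\beta\sum_{(i,j)\in E_N}\sigma_i\sigma_j+B\sum_i\sigma_i]\big)}{Q_N(Z_N(\beta,B))}.$$ Define $\lambda_\pm=\lambda_\pm(B)=e^{\beta}\big[\cosh B\pm\sqrt{\sinh^2 B+e^{-4\beta}}\big]$,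 $$A_\pm=A_\pm(B)=\frac{e^{-2\beta}e^{\pm B}+(\lambda_+-e^{\beta+B})^2e^{\mp B}\pm 2e^{-\beta}(\lambda_+-e^{\beta+B})}{[e^{-2\beta}+(\lambda_+-e^{\beta+B})^2]\,\lambda_\pm},\qquad r=\frac{\lambda_-}{\lambda_+},\quad a=\frac{A_-}{A_+}.$$ For $B\ne0$ let $I(B)=\max H(s,t)$ over $(s,t)\in[0,\frac{1-p}2]\times[0,p]$, where, with $0\log 0=0$, $$\begin{aligned}H(s,t)={}&(1-p)\log\tfrac{1-p}2-2s\log s-2\big(\tfrac{1-p}2-s\big)\log\big(\tfrac{1-p}2-s\big)+s\log(ar^2)+t\log r\\&+(s+t)\log(s+t)-t\log t+\big(\tfrac{1+p}2-s-t\big)\log\big(\tfrac{1+p}2-s-t\big)\\&-(p-t)\log(p-t)-\tfrac{1+p}2\log\tfrac{1+p}2+p\log p,\end{aligned}$$ and let $I(0)=0$. Then $I$ is an exponential rate: as $N\to\infty$, for every $b\in\mathbb R$, $$\frac1N\log\frac{Q_N(Z_N(\beta,b))}{\lambda_+(b)^N A_+(b)^{n_1/2}}\longrightarrow I(b).$$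 Moreover $I$ is twice continuously differentiable near $B$, the number $$\sigma_2^2=\frac{d^2}{dB^2}\log\lambda_+(B)+\frac{1-p}2\,\frac{d^2}{dB^2}\log A_+(B)+\frac{d^2}{dB^2}I(B)$$ is nonnegative, and, as $N\to\infty$, $$\frac{S_N-\widetilde P_N(S_N)}{\sqrt N}\ \xrightarrow{\ \mathcal D\ }\ \mathcal N(0,\sigma_2^2)\qquad\text{w.r.t. }\widetilde P_N.$$ -/

import Mathlib

open Filter Topology MeasureTheory ProbabilityTheory

namespace AnnealedCM

noncomputable section

/-! ### The configuration model -/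

/-- The half-edges of a degree sequence `d`: `d i` half-edges at the vertex `i`. -/
abbrev HalfEdge {N : ℕ} (d : Fin N → ℕ) : Type := Σ i : Fin N, Fin (d i)

/-- A pairing of the half-edges, encoded as a fixed-point-free involution. The pair
`{h, π h}` is an edge of the multigraph, joining the vertices `h.1` and `(π h).1`. -/
abbrev Pairing {N : ℕ} (d : Fin N → ℕ) : Type :=
  {π : Equiv.Perm (HalfEdge d) // ∀ h, π (π h) = h ∧ π h ≠ h}

/-- Expectation over the configuration model, i.e. over a uniformly chosen pairing. -/
def graphMean {N : ℕ} {d : Fin N → ℕ} (f : Pairing d → ℝ) : ℝ :=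
  (∑ π, f π) / (Fintype.card (Pairing d) : ℝ)

/-! ### The annealed Ising model -/

/-- Spin configurations; `ℤˣ = {1, -1}`. -/
abbrev Spins (N : ℕ) : Type := Fin N → ℤˣ

/-- The value in `{-1, 1}` of the spin at `i`, as a real number. -/
def spin {N : ℕ} (σ : Spins N) (i : Fin N) : ℝ := ((σ i : ℤ) : ℝ)

def totalSpin {N : ℕ} (σ : Spins N) : ℝ := ∑ i, spin σ i

/-- The sum of `σ_i σ_j` over the edges of the multigraph, self-loops and multiple edges
included. Every edge consists of two half-edges, whence the factor `1 / 2`. -/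
def edgeSum {N : ℕ} {d : Fin N → ℕ} (π : Pairing d) (σ : Spins N) : ℝ :=
  (1 / 2) * ∑ h : HalfEdge d, spin σ h.1 * spin σ (π.1 h).1

def boltzmannWeight (β B : ℝ) {N : ℕ} {d : Fin N → ℕ} (σ : Spins N) (π : Pairing d) : ℝ :=
  Real.exp (β * edgeSum π σ + B * totalSpin σ)

def partitionFunction (β B : ℝ) {N : ℕ} {d : Fin N → ℕ} (π : Pairing d) : ℝ :=
  ∑ σ : Spins N, boltzmannWeight β B σ π

/-- The annealed probability of a spin configuration. -/
def annealedProb (β B : ℝ) {N : ℕ} (d : Fin N → ℕ) (σ : Spins N) : ℝ :=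
  graphMean (boltzmannWeight β B σ : Pairing d → ℝ) /
    graphMean (partitionFunction β B : Pairing d → ℝ)

/-- The annealed measure on spin configurations. -/
def annealedMeasure (β B : ℝ) {N : ℕ} (d : Fin N → ℕ) : Measure (Spins N) :=
  ∑ σ : Spins N, ENNReal.ofReal (annealedProb β B d σ) • Measure.dirac σ

/-- The sizes `N` for which the total degree is even, so that the configuration model exists. -/
abbrev EvenSize (d : (N : ℕ) → Fin N → ℕ) : Type := {N : ℕ // Even (∑ i, d N i)}

theorem nonempty_pairing {N : ℕ} {d : Fin N → ℕ} (h : Even (∑ i, d i)) :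
    Nonempty (Pairing d) := by
  obtain ⟨k, hk⟩ := h
  have hc : Fintype.card (HalfEdge d) = Fintype.card (Fin k × Bool) := by
    simp [hk]; ring
  let e : HalfEdge d ≃ Fin k × Bool := Fintype.equivOfCardEq hc
  let s : Equiv.Perm (Fin k × Bool) := Equiv.prodCongr (Equiv.refl _) Equiv.boolNot
  refine ⟨⟨(e.trans s).trans e.symm, fun x => ⟨?_, ?_⟩⟩⟩
  · have hs : ∀ y, s (s y) = y := fun y => by ext <;> simp [s]
    simp [hs]
  · intro hx
    have h2 : s (e x) = e x := by
      have := congrArg e hx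
      simpa using this
    have h3 := congrArg Prod.snd h2
    simp [s] at h3

theorem boltzmannWeight_pos (β B : ℝ) {N : ℕ} {d : Fin N → ℕ} (σ : Spins N) (π : Pairing d) :
    0 < boltzmannWeight β B σ π := Real.exp_pos _

theorem isProbabilityMeasure_annealedMeasure (β B : ℝ) {N : ℕ} {d : Fin N → ℕ}
    (h : Even (∑ i, d i)) : IsProbabilityMeasure (annealedMeasure β B d) := by
  have := nonempty_pairing h
  have hcard : (0 : ℝ) < (Fintype.card (Pairing d) : ℝ) := by
    exact_mod_cast Fintype.card_pos
  have hZ : 0 < graphMean (partitionFunction β B : Pairing d → ℝ) := by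
    refine div_pos (Finset.sum_pos (fun π _ => ?_) Finset.univ_nonempty) hcard
    exact Finset.sum_pos (fun σ _ => boltzmannWeight_pos β B σ π) Finset.univ_nonempty
  have hnn : ∀ σ : Spins N, 0 ≤ annealedProb β B d σ := fun σ =>
    div_nonneg (div_nonneg (Finset.sum_nonneg fun π _ => (boltzmannWeight_pos β B σ π).le)
      hcard.le) hZ.le
  have hsum : ∑ σ : Spins N, annealedProb β B d σ = 1 := by
    unfold annealedProb
    rw [← Finset.sum_div, div_eq_one_iff_eq hZ.ne']
    unfold graphMean partitionFunction
    rw [← Finset.sum_div, Finset.sum_comm]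
  constructor
  unfold annealedMeasure
  simp only [Measure.coe_finsetSum, Finset.sum_apply, Measure.smul_apply, measure_univ,
    smul_eq_mul, mul_one]
  rw [← ENNReal.ofReal_sum_of_nonneg (fun σ _ => hnn σ), hsum, ENNReal.ofReal_one]

instance (β B : ℝ) (d : (N : ℕ) → Fin N → ℕ) (N : EvenSize d) :
    IsProbabilityMeasure (annealedMeasure β B (d N.1)) :=
  isProbabilityMeasure_annealedMeasure β B N.2

/-! ### The limiting variance -/

/-- The two eigenvalues of the one-dimensional Ising transfer matrix. -/
def lambdaPlus (β B : ℝ) : ℝ :=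
  Real.exp β * (Real.cosh B + Real.sqrt (Real.sinh B ^ 2 + Real.exp (-4 * β)))

def lambdaMinus (β B : ℝ) : ℝ :=
  Real.exp β * (Real.cosh B - Real.sqrt (Real.sinh B ^ 2 + Real.exp (-4 * β)))

/-- The coefficients in the partition function `A₊ λ₊ ^ n + A₋ λ₋ ^ n` of a line of
`n` vertices. -/
def APlus (β B : ℝ) : ℝ :=
  (Real.exp (-2 * β) * Real.exp B + (lambdaPlus β B - Real.exp (β + B)) ^ 2 * Real.exp (-B)
      + 2 * Real.exp (-β) * (lambdaPlus β B - Real.exp (β + B))) /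
    ((Real.exp (-2 * β) + (lambdaPlus β B - Real.exp (β + B)) ^ 2) * lambdaPlus β B)

def AMinus (β B : ℝ) : ℝ :=
  (Real.exp (-2 * β) * Real.exp (-B) + (lambdaPlus β B - Real.exp (β + B)) ^ 2 * Real.exp B
      - 2 * Real.exp (-β) * (lambdaPlus β B - Real.exp (β + B))) /
    ((Real.exp (-2 * β) + (lambdaPlus β B - Real.exp (β + B)) ^ 2) * lambdaMinus β B)

def ratioLambda (β B : ℝ) : ℝ := lambdaMinus β B / lambdaPlus β B

def ratioA (β B : ℝ) : ℝ := AMinus β B / APlus β B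

/-- The entropy-energy function `H(s, t)`, with `0 log 0 = 0` on the boundary of its domain.
For `β > 0` both `ratioLambda` and, if `B ≠ 0`, `ratioA` are positive. -/
def H (p β B s t : ℝ) : ℝ :=
  (1 - p) * Real.log ((1 - p) / 2) - 2 * s * Real.log s
    - 2 * ((1 - p) / 2 - s) * Real.log ((1 - p) / 2 - s)
    + s * Real.log (ratioA β B * ratioLambda β B ^ 2) + t * Real.log (ratioLambda β B)
    + (s + t) * Real.log (s + t) - t * Real.log t
    + ((1 + p) / 2 - s - t) * Real.log ((1 + p) / 2 - s - t)
    - (p - t) * Real.log (p - t) - (1 + p) / 2 * Real.log ((1 + p) / 2) + p * Real.log p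

/-- The exponential rate `I(B)` of the generating function of the line lengths
(the graph average of `∏ (1 + a r ^ l)` over the lines, with `a = ratioA β B`,
`r = ratioLambda β B` and `l` the number of vertices of the line): the maximum of
`H` over `[0, (1 - p) / 2] × [0, p]` if `B ≠ 0`. At `B = 0` one has `a = 0`,
the generating function is `1`, and the rate is `0`. -/
def lineRate (p β B : ℝ) : ℝ :=
  if B = 0 then 0
  else sSup ((fun x : ℝ × ℝ => H p β B x.1 x.2) '' (Set.Icc 0 ((1 - p) / 2) ×ˢ Set.Icc 0 p))

/-- The variance `σ₂²`. -/
def sigmaSq (p β B : ℝ) : ℝ :=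
  iteratedDeriv 2 (fun b => Real.log (lambdaPlus β b)) B
    + (1 - p) / 2 * iteratedDeriv 2 (fun b => Real.log (APlus β b)) B
    + iteratedDeriv 2 (lineRate p β) B

end

end AnnealedCM

open AnnealedCM

/-! The argument is of Lee–Yang type. The moment generating function of the total spin under the
annealed measure is a ratio of annealed partition functions at shifted fields. Suppose these have no
complex zeros in a disc around `B` whose radius does not depend on `N`, and that the pressure
converges at every real field. The logarithm divided by `N` is then holomorphic on the disc. Its
real part is bounded above because `|S_N| ≤ N`, so Borel–Carathéodory bounds its Taylor coefficients
uniformly in `N`. Compactness upgrades real pointwise convergence to convergence of all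
coefficients, and the limit is analytic. Evaluation at `iθ/√N` gives the Gaussian limit, with the
second derivative of the pressure as variance (`tendsto_charFun_of_zeroFree`). Smoothness of
`lineRate` follows by subtracting the explicit smooth terms from the pressure, so the maximizer of
`H` never has to be analysed.

Both inputs come from one identity (`choose_mul_annealedPartition`). If the edge weight is a
symmetrized product, `a s * b t + b s * a t = 2 e^{β s t}`, then choosing an orientation of every
pair turns the mean over pairings into a mean over subsets containing half of the half-edges. This
is the middle coefficient of a product of polynomials, one per half-edge, and the sum over spins
factorizes over vertices.

Conjugate complex amplitudes make every vertex polynomial, for fields near `B`, a product of linear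
factors with roots in the open left half-plane. By Gauss–Lucas no coefficient of the product
vanishes (`exists_forall_annealedPartition_ne_zero`). Amplitudes built from the eigenvectors of the
transfer matrix instead make the vertex polynomials combinations of powers of `1 + X` and `1 - X`,
whose middle coefficients are explicit. This yields a finite positive double sum
(`graphMean_partitionFunction_eq_lineSum`), and Stirling's formula with Laplace's method gives its
rate, the maximum of `H` (`tendsto_lineRate`). At `B = 0` the coefficient `AMinus` vanishes and the
rate is `0`. -/

namespace AnnealedCM

/-! ### Cumulants and the CLT from zero-free Laplace transforms. -/

/-- Moment generating function of `S` under the weights `w`, at a complex argument. -/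
noncomputable def complexLaplace {Ω : Type*} [Fintype Ω] (w S : Ω → ℝ) (z : ℂ) : ℂ :=
  ∑ ω, (w ω : ℂ) * Complex.exp (z * S ω)

section Laplace

variable {Ω : Type*} [Fintype Ω] {w S : Ω → ℝ}

theorem hasDerivAt_complexLaplace (w S : Ω → ℝ) (z : ℂ) :
    HasDerivAt (complexLaplace w S) (complexLaplace (fun ω => w ω * S ω) S z) z := by
  unfold complexLaplace
  refine HasDerivAt.fun_sum fun ω _ => ?_
  have h := (((hasDerivAt_id z).mul_const (S ω : ℂ)).cexp).const_mul (w ω : ℂ)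
  refine h.congr_deriv ?_
  push_cast
  simp only [id]
  ring

theorem differentiable_complexLaplace (w S : Ω → ℝ) : Differentiable ℂ (complexLaplace w S) :=
  fun z => (hasDerivAt_complexLaplace w S z).differentiableAt

theorem complexLaplace_zero (w S : Ω → ℝ) : complexLaplace w S 0 = ((∑ ω, w ω : ℝ) : ℂ) := by
  simp [complexLaplace]

/-- After taking logarithms and dividing by `n`, this is an upper bound on the real part that is
uniform in the size: the one-sided input that Borel–Carathéodory needs. -/
theorem norm_complexLaplace_le {n : ℝ} (hw : ∀ ω, 0 ≤ w ω) (hsum : ∑ ω, w ω = 1)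
    (hS : ∀ ω, |S ω| ≤ n) (z : ℂ) : ‖complexLaplace w S z‖ ≤ Real.exp (n * ‖z‖) := by
  calc ‖complexLaplace w S z‖ ≤ ∑ ω, w ω * Real.exp (n * ‖z‖) := by
        refine (norm_sum_le _ _).trans (Finset.sum_le_sum fun ω _ => ?_)
        rw [norm_mul, Complex.norm_real, Real.norm_of_nonneg (hw ω), Complex.norm_exp]
        refine mul_le_mul_of_nonneg_left (Real.exp_le_exp.2 ?_) (hw ω)
        calc (z * (S ω : ℂ)).re ≤ ‖z * (S ω : ℂ)‖ := Complex.re_le_norm _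
          _ = ‖z‖ * |S ω| := by rw [norm_mul, Complex.norm_real, Real.norm_eq_abs]
          _ ≤ n * ‖z‖ := by rw [mul_comm]; gcongr; exact hS ω
    _ = Real.exp (n * ‖z‖) := by rw [← Finset.sum_mul, hsum, one_mul]

/-- A holomorphic logarithm of a nonvanishing function on a disc. -/
theorem exists_log_on_ball {f : ℂ → ℂ} {R : ℝ} (hf : Differentiable ℂ f) (h1 : f 0 = 1)
    (hR : 0 < R) (h0 : ∀ z ∈ Metric.ball (0 : ℂ) R, f z ≠ 0) :
    ∃ g : ℂ → ℂ, g 0 = 0 ∧ DifferentiableOn ℂ g (Metric.ball 0 R) ∧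
      ∀ z ∈ Metric.ball (0 : ℂ) R, f z = Complex.exp (g z) := by
  have hd : DifferentiableOn ℂ (fun z => deriv f z / f z) (Metric.ball 0 R) :=
    (hf.contDiff (n := 2)).differentiable_deriv_two.differentiableOn.div hf.differentiableOn h0
  obtain ⟨g, hg0, hg⟩ := hd.isExactOn_ball.with_val_at 0 0
  refine ⟨g, hg0, fun z hz => (hg z hz).differentiableAt.differentiableWithinAt, fun z hz => ?_⟩
  have hconst : ∀ z ∈ Metric.ball (0 : ℂ) R,
      HasDerivAt (fun z => f z * Complex.exp (-g z)) 0 z := by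
    intro z hz
    have h := (hf z).hasDerivAt.mul (hg z hz).neg.cexp
    refine h.congr_deriv ?_
    have := h0 z hz
    field_simp
    ring
  have hk := (convex_ball (0 : ℂ) R).is_const_of_fderivWithin_eq_zero (𝕜 := ℂ)
    (f := fun z => f z * Complex.exp (-g z))
    (fun z hz => (hconst z hz).differentiableAt.differentiableWithinAt)
    (fun z hz => by
      rw [fderivWithin_of_isOpen Metric.isOpen_ball hz]
      ext
      simp [(hconst z hz).hasFDerivAt.fderiv]) hz (Metric.mem_ball_self hR)
  simp only [h1, hg0, neg_zero, Complex.exp_zero, mul_one] at hk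
  calc f z = f z * Complex.exp (-g z) * Complex.exp (g z) := by
        rw [mul_assoc, ← Complex.exp_add]; simp
    _ = _ := by rw [hk, one_mul]

/-- The normalized cumulant series of a bounded variable whose Laplace transform has no zeros
in a disc: its coefficients are bounded in terms of the radius only. -/
theorem exists_cumulant_series {n R : ℝ} (hn : 0 < n) (hR : 0 < R) (hw : ∀ ω, 0 ≤ w ω)
    (hsum : ∑ ω, w ω = 1) (hS : ∀ ω, |S ω| ≤ n)
    (h0 : ∀ z ∈ Metric.ball (0 : ℂ) R, complexLaplace w S z ≠ 0) :
    ∃ c : ℕ → ℂ, (∀ k, ‖c k‖ ≤ 2 * R / (R / 2) ^ k) ∧ c 0 = 0 ∧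
      n * c 1 = ((∑ ω, w ω * S ω : ℝ) : ℂ) ∧ (∃ v : ℝ, 0 ≤ v ∧ c 2 = v) ∧
      ∀ z ∈ Metric.ball (0 : ℂ) (R / 2),
        complexLaplace w S z = Complex.exp (n * ∑' k, c k * z ^ k) := by
  have hf := differentiable_complexLaplace w S
  have hf1 : complexLaplace w S 0 = 1 := by rw [complexLaplace_zero, hsum]; simp
  obtain ⟨g, hg0, hgd, hg⟩ := exists_log_on_ball hf hf1 hR h0
  have hnC : (n : ℂ) ≠ 0 := by exact_mod_cast hn.ne'
  set h : ℂ → ℂ := fun z => g z / n with hh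
  have hgh : ∀ z, g z = n * h z := fun z => by simp only [hh]; field_simp
  have hhd : DifferentiableOn ℂ h (Metric.ball 0 R) := hgd.div_const _
  have hh0 : h 0 = 0 := by simp [hh, hg0]
  have hre : Set.MapsTo h (Metric.ball 0 R) {z | z.re ≤ R} := by
    intro z hz
    have hb := norm_complexLaplace_le hw hsum hS z
    rw [hg z hz, Complex.norm_exp, Real.exp_le_exp, hgh z, Complex.re_ofReal_mul] at hb
    have : (h z).re ≤ ‖z‖ := le_of_mul_le_mul_left hb hn
    exact this.trans (mem_ball_zero_iff.1 hz).le
  have hsub : Metric.closedBall (0 : ℂ) (R / 2) ⊆ Metric.ball 0 R :=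
    Metric.closedBall_subset_ball (by linarith)
  have hsub' : Metric.ball (0 : ℂ) (R / 2) ⊆ Metric.ball 0 R := Metric.ball_subset_ball (by linarith)
  -- Borel–Carathéodory gives `2R‖z‖ / (R - ‖z‖)`, which equals `2R` at `‖z‖ = R / 2`; Cauchy's
  -- estimates on this circle then bound the coefficients.
  have hbound : ∀ z ∈ Metric.sphere (0 : ℂ) (R / 2), ‖h z‖ ≤ 2 * R := by
    intro z hz
    have hz' : ‖z‖ = R / 2 := by simpa using hz
    have := Complex.borelCaratheodory_zero hR hhd hre hR
      (hsub (Metric.sphere_subset_closedBall hz)) hh0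
    rw [hz'] at this
    refine this.trans (le_of_eq ?_)
    field_simp
    ring
  have hdc : DiffContOnCl ℂ h (Metric.ball 0 (R / 2)) :=
    (hhd.mono (by rw [closure_ball _ (by positivity)]; exact hsub)).diffContOnCl
  have hev : ∀ᶠ z in 𝓝 (0 : ℂ), z ∈ Metric.ball (0 : ℂ) R := Metric.ball_mem_nhds _ hR
  have hderiv : ∀ z ∈ Metric.ball (0 : ℂ) R,
      complexLaplace (fun ω => w ω * S ω) S z = n * deriv h z * complexLaplace w S z := by
    intro z hz
    have hz' : Metric.ball (0 : ℂ) R ∈ 𝓝 z := Metric.isOpen_ball.mem_nhds hz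
    have h1 := (((hhd z hz).differentiableAt hz').hasDerivAt.const_mul (n : ℂ)).cexp
    have h2 := h1.congr_of_eventuallyEq (f₁ := complexLaplace w S)
      (by filter_upwards [hz'] with y hy using by rw [hg y hy, hgh y])
    rw [← (hasDerivAt_complexLaplace w S z).unique h2 |>.symm, hg z hz, hgh z]
    ring
  have hmean : (n : ℂ) * deriv h 0 = ((∑ ω, w ω * S ω : ℝ) : ℂ) := by
    have := hderiv 0 (Metric.mem_ball_self hR)
    rw [complexLaplace_zero, hf1, mul_one] at this
    exact this.symm
  refine ⟨fun k => (k.factorial : ℂ)⁻¹ * iteratedDeriv k h 0, fun k => ?_, by simp [hh0], ?_, ?_, ?_⟩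
  · have := Complex.norm_iteratedDeriv_le_of_forall_mem_sphere_norm_le k (by positivity) hdc hbound
    rw [norm_mul, norm_inv, Complex.norm_natCast, inv_mul_le_iff₀ (by positivity), ← mul_div_assoc]
    exact this
  · simpa using hmean
  -- Differentiating `L' = n h' L` once more at `0` gives `n h''(0) = Var S`, so the second
  -- coefficient is `Var S / (2n)`, real and nonnegative.
  · have hd2 : HasDerivAt (fun z => (n : ℂ) * deriv h z * complexLaplace w S z)
        (n * deriv (deriv h) 0 * complexLaplace w S 0 +
          n * deriv h 0 * complexLaplace (fun ω => w ω * S ω) S 0) 0 := by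
      have hdd : DifferentiableAt ℂ (deriv h) 0 :=
        ((hhd.deriv Metric.isOpen_ball) 0 (Metric.mem_ball_self hR)).differentiableAt
          (Metric.ball_mem_nhds _ hR)
      exact (hdd.hasDerivAt.const_mul _).mul (hasDerivAt_complexLaplace w S 0)
    have hd2' := (hasDerivAt_complexLaplace (fun ω => w ω * S ω) S 0).unique
      (hd2.congr_of_eventuallyEq (by filter_upwards [hev] with y hy using hderiv y hy))
    rw [hf1, complexLaplace_zero, complexLaplace_zero, mul_one, hmean] at hd2'
    have hexp : ∀ m : ℝ, ∑ ω, w ω * (S ω - m) ^ 2 =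
        (∑ ω, w ω * S ω * S ω) - 2 * m * (∑ ω, w ω * S ω) + m ^ 2 * ∑ ω, w ω := by
      intro m
      rw [Finset.mul_sum, Finset.mul_sum, ← Finset.sum_sub_distrib, ← Finset.sum_add_distrib]
      exact Finset.sum_congr rfl fun ω _ => by ring
    set m : ℝ := ∑ ω, w ω * S ω with hm
    set s : ℝ := ∑ ω, w ω * S ω * S ω with hs
    have hvar : m * m ≤ s := by
      have : 0 ≤ ∑ ω, w ω * (S ω - m) ^ 2 :=
        Finset.sum_nonneg fun ω _ => mul_nonneg (hw ω) (sq_nonneg _)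
      rw [hexp, hsum] at this
      nlinarith
    refine ⟨(s - m * m) / (2 * n), div_nonneg (by linarith) (by positivity), ?_⟩
    have hi : iteratedDeriv 2 h 0 = deriv (deriv h) 0 := by
      rw [iteratedDeriv_succ, iteratedDeriv_one]
    have : deriv (deriv h) 0 = (s - m * m) / n := by
      rw [eq_div_iff hnC, hd2']
      ring
    simp only [hi, this]
    push_cast [Nat.factorial]
    field_simp
  · intro z hz
    rw [hg z (hsub' hz), hgh z, ← (Complex.hasSum_taylorSeries_on_ball hhd (hsub' hz)).tsum_eq]
    congr 2
    refine tsum_congr fun k => ?_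
    simp only [smul_eq_mul, sub_zero]
    ring

end Laplace

/-- If power series with uniformly bounded coefficients converge pointwise on a real interval,
then the limit is analytic and the coefficients converge. -/
theorem analyticAt_of_tendsto_powerSeries {ι : Type*} {l : Filter ι} [l.NeBot] {C ρ : ℝ}
    (hρ : 0 < ρ) {c : ι → ℕ → ℝ} (hc : ∀ᶠ i in l, ∀ k, |c i k| ≤ C / ρ ^ k) {q : ℝ → ℝ}
    (hq : ∀ x, |x| < ρ → Tendsto (fun i => ∑' k, c i k * x ^ k) l (𝓝 (q x))) :
    AnalyticAt ℝ q 0 ∧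
      ∀ k : ℕ, Tendsto (fun i => c i k) l (𝓝 (iteratedDeriv k q 0 / k.factorial)) := by
  -- Along an ultrafilter the bounded coefficients converge, and dominated convergence shows that
  -- their limits are coefficients of `q`. A function has only one power series at `0`, so the
  -- limits do not depend on the ultrafilter, and convergence along `l` follows.
  have key : ∀ U : Ultrafilter ι, (U : Filter ι) ≤ l → ∃ a : ℕ → ℝ,
      (∀ k, Tendsto (fun i => c i k) U (𝓝 (a k))) ∧
        HasFPowerSeriesAt q (FormalMultilinearSeries.ofScalars ℝ a) 0 := by
    intro U hU
    have hcU := hU hc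
    have : ∀ k, ∃ x, Tendsto (fun i => c i k) U (𝓝 x) := by
      intro k
      have hmem : Metric.closedBall (0 : ℝ) (C / ρ ^ k) ∈ U.map (fun i => c i k) := by
        rw [Ultrafilter.mem_map]
        refine mem_of_superset hcU fun i hi => ?_
        simpa using hi k
      obtain ⟨x, -, hx⟩ := (isCompact_closedBall (0 : ℝ) (C / ρ ^ k)).ultrafilter_le_nhds' _ hmem
      exact ⟨x, hx⟩
    choose a ha using this
    have hak : ∀ k, |a k| ≤ C / ρ ^ k := fun k =>
      le_of_tendsto (ha k).abs (mem_of_superset hcU fun i hi => hi k)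
    refine ⟨a, ha, hasFPowerSeriesAt_iff.2 ?_⟩
    filter_upwards [Metric.ball_mem_nhds (0 : ℝ) hρ] with x hx
    have hx' : |x| < ρ := by simpa using hx
    have hle : ∀ (b : ℕ → ℝ), (∀ k, |b k| ≤ C / ρ ^ k) → ∀ k, ‖b k * x ^ k‖ ≤ C * (|x| / ρ) ^ k := by
      intro b hb k
      rw [norm_mul, norm_pow, Real.norm_eq_abs, Real.norm_eq_abs, div_pow]
      calc |b k| * |x| ^ k ≤ C / ρ ^ k * |x| ^ k := by gcongr; exact hb k
        _ = _ := by ring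
    have hs : Summable fun k : ℕ => C * (|x| / ρ) ^ k :=
      (summable_geometric_of_lt_one (by positivity) ((div_lt_one hρ).2 hx')).mul_left _
    have ht := tendsto_tsum_of_dominated_convergence (𝓕 := (U : Filter ι)) hs
      (fun k => (ha k).mul_const (x ^ k)) (mem_of_superset hcU fun i hi => hle _ hi)
    have heq : ∑' k, a k * x ^ k = q x := tendsto_nhds_unique ht ((hq x hx').mono_left hU)
    have := (Summable.of_norm_bounded hs (hle a hak)).hasSum
    rw [heq] at this
    simpa [FormalMultilinearSeries.coeff_ofScalars, mul_comm] using this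
  obtain ⟨U, hU⟩ := Ultrafilter.exists_le l
  obtain ⟨a, -, ha⟩ := key U hU
  have hq0 : AnalyticAt ℝ q 0 := ha.analyticAt
  refine ⟨hq0, fun k => tendsto_iff_ultrafilter _ _ _ |>.2 fun V hV => ?_⟩
  obtain ⟨b, hb, hb'⟩ := key V hV
  have := congrArg (fun p => FormalMultilinearSeries.coeff p k)
    (hb'.eq_formalMultilinearSeries hq0.hasFPowerSeriesAt)
  simp only [FormalMultilinearSeries.coeff_ofScalars] at this
  rw [← this]
  exact hb k

theorem norm_mul_pow_le_geometric {𝕜 : Type*} [NormedField 𝕜] {C ρ : ℝ} {a : ℕ → 𝕜}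
    (ha : ∀ k, ‖a k‖ ≤ C / ρ ^ k) (z : 𝕜) (k : ℕ) : ‖a k * z ^ k‖ ≤ C * (‖z‖ / ρ) ^ k := by
  rw [norm_mul, norm_pow, div_pow]
  calc ‖a k‖ * ‖z‖ ^ k ≤ C / ρ ^ k * ‖z‖ ^ k := by gcongr; exact ha k
    _ = _ := by ring

theorem summable_mul_pow_of_norm_le {C ρ : ℝ} (hρ : 0 < ρ) {a : ℕ → ℂ}
    (ha : ∀ k, ‖a k‖ ≤ C / ρ ^ k) {z : ℂ} (hz : ‖z‖ < ρ) : Summable fun k => a k * z ^ k :=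
  .of_norm_bounded ((summable_geometric_of_lt_one (by positivity) ((div_lt_one hρ).2 hz)).mul_left C)
    (norm_mul_pow_le_geometric ha z)

/-- Third-order Taylor estimate for a power series with geometrically bounded coefficients. -/
theorem norm_tsum_sub_taylor_two_le {C ρ : ℝ} (hρ : 0 < ρ) (hC : 0 ≤ C) {a : ℕ → ℂ}
    (ha : ∀ k, ‖a k‖ ≤ C / ρ ^ k) (ha0 : a 0 = 0) {z : ℂ} (hz : ‖z‖ ≤ ρ / 2) :
    ‖∑' k, a k * z ^ k - a 1 * z - a 2 * z ^ 2‖ ≤ 2 * C * (‖z‖ / ρ) ^ 3 := by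
  have hs := summable_mul_pow_of_norm_le hρ ha (hz.trans_lt (by linarith))
  have h3 := hs.sum_add_tsum_nat_add 3
  simp only [Finset.sum_range_succ, Finset.sum_range_zero, ha0, pow_one, zero_mul, zero_add] at h3
  rw [show ∑' k, a k * z ^ k - a 1 * z - a 2 * z ^ 2 = ∑' k, a (k + 3) * z ^ (k + 3) by
    rw [← h3]; ring]
  have hx : ‖z‖ / ρ ≤ 1 / 2 := by rw [div_le_iff₀ hρ]; linarith
  have hg := summable_geometric_of_lt_one (r := ‖z‖ / ρ) (by positivity) (by linarith)
  have hsum : HasSum (fun k : ℕ => C * (‖z‖ / ρ) ^ 3 * (‖z‖ / ρ) ^ k)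
      (C * (‖z‖ / ρ) ^ 3 * (1 - ‖z‖ / ρ)⁻¹) :=
    (hasSum_geometric_of_lt_one (by positivity) (by linarith)).mul_left _
  refine (tsum_of_norm_bounded hsum fun k => ?_).trans ?_
  · refine (norm_mul_pow_le_geometric ha z (k + 3)).trans (le_of_eq ?_)
    ring
  · have : (1 - ‖z‖ / ρ)⁻¹ ≤ 2 := by
      rw [inv_le_comm₀ (by linarith) (by norm_num)]; linarith
    calc _ ≤ C * (‖z‖ / ρ) ^ 3 * 2 := by gcongr
      _ = _ := by ring

/-- Central limit theorem for bounded variables whose Laplace transforms have no zeros in a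
common disc, in terms of characteristic functions. The limiting variance is the second
derivative of the limiting normalized cumulant generating function. -/
theorem tendsto_charFun_of_zeroFree {ι : Type*} {l : Filter ι} [l.NeBot] {Ω : ι → Type*}
    [∀ i, Fintype (Ω i)] {w S : ∀ i, Ω i → ℝ} {n : ι → ℝ} (hn : Tendsto n l atTop) {R : ℝ}
    (hR : 0 < R) (hw : ∀ i ω, 0 ≤ w i ω) (hsum : ∀ i, ∑ ω, w i ω = 1)
    (hS : ∀ i ω, |S i ω| ≤ n i)
    (h0 : ∀ i, ∀ z ∈ Metric.ball (0 : ℂ) R, complexLaplace (w i) (S i) z ≠ 0) {q : ℝ → ℝ}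
    (hq : ∀ x : ℝ, |x| < R → Tendsto
      (fun i => (1 / n i) * Real.log (∑ ω, w i ω * Real.exp (x * S i ω))) l (𝓝 (q x))) :
    AnalyticAt ℝ q 0 ∧ 0 ≤ iteratedDeriv 2 q 0 ∧
      ∀ θ : ℝ, Tendsto (fun i => ∑ ω, (w i ω : ℂ) * Complex.exp
          ((θ * ((S i ω - ∑ τ, w i τ * S i τ) / √(n i)) : ℝ) * Complex.I)) l
        (𝓝 (Complex.exp (-(iteratedDeriv 2 q 0 * θ ^ 2 / 2 : ℝ)))) := by
  -- The guard `0 < n i` allows for degenerate sizes, which are eventually excluded.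
  have hex : ∀ i, ∃ c : ℕ → ℂ, 0 < n i → (∀ k, ‖c k‖ ≤ 2 * R / (R / 2) ^ k) ∧ c 0 = 0 ∧
      n i * c 1 = ((∑ ω, w i ω * S i ω : ℝ) : ℂ) ∧ (∃ v : ℝ, 0 ≤ v ∧ c 2 = v) ∧
      ∀ z ∈ Metric.ball (0 : ℂ) (R / 2),
        complexLaplace (w i) (S i) z = Complex.exp (n i * ∑' k, c k * z ^ k) := by
    intro i
    by_cases hi : 0 < n i
    · obtain ⟨c, hc⟩ := exists_cumulant_series hi hR (hw i) (hsum i) (hS i) (h0 i)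
      exact ⟨c, fun _ => hc⟩
    · exact ⟨0, fun h => absurd h hi⟩
  choose c hc using hex
  have hpos : ∀ᶠ i in l, 0 < n i := hn.eventually_gt_atTop 0
  have hR2 : 0 < R / 2 := by positivity
  obtain ⟨hqa, hqc⟩ := analyticAt_of_tendsto_powerSeries (l := l) (C := 2 * R) hR2
    (c := fun i k => (c i k).re) (q := q)
    (by filter_upwards [hpos] with i hi k using (Complex.abs_re_le_norm _).trans ((hc i hi).1 k))
    (by
      intro x hx
      refine (hq x (by linarith)).congr' ?_
      filter_upwards [hpos] with i hi
      obtain ⟨hb, -, -, -, he⟩ := hc i hi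
      have hxn : ‖(x : ℂ)‖ < R / 2 := by simpa using hx
      have h1 := he x (mem_ball_zero_iff.2 hxn)
      have h2 : complexLaplace (w i) (S i) x =
          ((∑ ω, w i ω * Real.exp (x * S i ω) : ℝ) : ℂ) := by
        simp [complexLaplace]
      have h3 : 0 ≤ ∑ ω, w i ω * Real.exp (x * S i ω) :=
        Finset.sum_nonneg fun ω _ => mul_nonneg (hw i ω) (Real.exp_pos _).le
      have h4 := congrArg norm h1
      rw [h2, Complex.norm_real, Real.norm_of_nonneg h3, Complex.norm_exp,
        Complex.re_ofReal_mul, Complex.re_tsum (summable_mul_pow_of_norm_le hR2 hb hxn)] at h4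
      rw [h4, Real.log_exp, one_div, inv_mul_cancel_left₀ hi.ne']
      refine tsum_congr fun k => ?_
      rw [← Complex.ofReal_pow, Complex.re_mul_ofReal])
  have h2 := hqc 2
  set σ := iteratedDeriv 2 q 0 with hσ
  have h2' : Tendsto (fun i => (c i 2).re) l (𝓝 (σ / 2)) := by simpa using h2
  have hσ0 : 0 ≤ σ / 2 := by
    refine ge_of_tendsto h2' ?_
    filter_upwards [hpos] with i hi
    obtain ⟨-, -, -, ⟨v, hv, hv'⟩, -⟩ := hc i hi
    simpa [hv'] using hv
  refine ⟨hqa, by linarith, fun θ => ?_⟩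
  have hsq : Tendsto (fun i => √(n i)) l atTop := Real.tendsto_sqrt_atTop.comp hn
  -- At `u = iθ/√n` the centring removes the linear term of `n ∑ c_k u ^ k`, the quadratic term is
  -- exactly `-θ² c_2`, and the remainder is `O(n^{-1/2})`.
  have hlim : Tendsto (fun i => -(θ ^ 2 * (c i 2).re : ℝ) +
      ((n i * (∑' k, c i k * (((θ / √(n i) : ℝ) : ℂ) * Complex.I) ^ k -
        c i 1 * (((θ / √(n i) : ℝ) : ℂ) * Complex.I) -
        c i 2 * (((θ / √(n i) : ℝ) : ℂ) * Complex.I) ^ 2)) : ℂ)) l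
      (𝓝 (-(σ * θ ^ 2 / 2 : ℝ))) := by
    rw [show (-(σ * θ ^ 2 / 2 : ℝ) : ℂ) = -(θ ^ 2 * (σ / 2) : ℝ) + 0 by push_cast; ring]
    refine Tendsto.add ((Complex.continuous_ofReal.tendsto _).comp (h2'.const_mul _)).neg ?_
    have hsmall : Tendsto (fun i => θ / √(n i)) l (𝓝 0) := hsq.const_div_atTop θ
    -- The Taylor bound with `C = 2R` and `ρ = R / 2`, multiplied by `n`; it applies once `|θ / √n|
    -- ≤ R / 4`.
    refine squeeze_zero_norm' (a := fun i => 4 * R * (|θ| / (R / 2)) ^ 3 / √(n i)) ?_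
      (hsq.const_div_atTop _)
    filter_upwards [hpos, (hsmall.abs).eventually (gt_mem_nhds
        (show |(0 : ℝ)| < R / 2 / 2 by simpa using hR))]
      with i hi hsm
    obtain ⟨hb, hc0, -, -, -⟩ := hc i hi
    have hnz : ‖((θ / √(n i) : ℝ) : ℂ) * Complex.I‖ = |θ / √(n i)| := by
      rw [norm_mul, Complex.norm_I, mul_one, Complex.norm_real, Real.norm_eq_abs]
    have := norm_tsum_sub_taylor_two_le hR2 (by positivity) hb hc0 (hnz.le.trans hsm.le)
    rw [norm_mul, Complex.norm_real, Real.norm_of_nonneg hi.le]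
    refine (mul_le_mul_of_nonneg_left this hi.le).trans (le_of_eq ?_)
    rw [hnz, abs_div, abs_of_nonneg (Real.sqrt_nonneg _)]
    have hs0 : √(n i) ≠ 0 := (Real.sqrt_pos.2 hi).ne'
    nth_rewrite 1 [← Real.sq_sqrt hi.le]
    field_simp
    ring
  refine ((Complex.continuous_exp.tendsto _).comp hlim).congr' ?_
  filter_upwards [hpos, (hsq.const_div_atTop θ).abs.eventually (gt_mem_nhds
      (show |(0 : ℝ)| < R / 2 by simpa using hR))]
    with i hi hsm
  obtain ⟨hb, hc0, hc1, ⟨v, -, hv⟩, he⟩ := hc i hi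
  have hs0 : (√(n i) : ℂ) ≠ 0 := by exact_mod_cast (Real.sqrt_pos.2 hi).ne'
  have hu : ‖((θ / √(n i) : ℝ) : ℂ) * Complex.I‖ < R / 2 := by
    rwa [norm_mul, Complex.norm_I, mul_one, Complex.norm_real, Real.norm_eq_abs]
  have he' := he _ (mem_ball_zero_iff.2 hu)
  set u : ℂ := ((θ / √(n i) : ℝ) : ℂ) * Complex.I with hudef
  have hu2 : n i * u ^ 2 = -(θ ^ 2 : ℝ) := by
    have : (n i : ℂ) = (√(n i) : ℂ) ^ 2 := by exact_mod_cast (Real.sq_sqrt hi.le).symm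
    rw [hudef, mul_pow, Complex.I_sq, this]
    push_cast
    field_simp
  have hsplit : ∑ ω, (w i ω : ℂ) * Complex.exp
      ((θ * ((S i ω - ∑ τ, w i τ * S i τ) / √(n i)) : ℝ) * Complex.I) =
      complexLaplace (w i) (S i) u * Complex.exp (-(n i * c i 1) * u) := by
    rw [hc1, complexLaplace, Finset.sum_mul]
    refine Finset.sum_congr rfl fun ω _ => ?_
    rw [mul_assoc, ← Complex.exp_add, hudef]
    congr 2
    push_cast
    ring
  rw [hsplit, he', ← Complex.exp_add, Function.comp]
  congr 1
  rw [hv] at *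
  simp only [Complex.ofReal_re]
  have : n i * (v * u ^ 2) = -(θ ^ 2 * v : ℝ) := by
    rw [mul_left_comm, hu2]; push_cast; ring
  linear_combination -this

/-! ### Averages over pairings as averages over half-sized subsets. -/

section Transversal

variable {X : Type*} [Fintype X]

/-- `S` contains exactly one point of every pair `{h, π h}`. -/
def IsTransversal (π : Equiv.Perm X) (S : Finset X) : Prop := ∀ h, h ∈ S ↔ π h ∉ S

theorem exists_isTransversal {π : Equiv.Perm X} (hπ : ∀ h, π (π h) = h ∧ π h ≠ h) :
    ∃ S, IsTransversal π S := by
  let e := Fintype.equivFin X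
  -- Keep from each pair the point that comes first in an arbitrary enumeration.
  refine ⟨Finset.univ.filter fun h => e h < e (π h), fun h => ?_⟩
  have hne : e (π h) ≠ e h := fun hh => (hπ h).2 (e.injective hh)
  simp only [Finset.mem_filter, Finset.mem_univ, true_and, (hπ h).1, not_lt]
  exact ⟨le_of_lt, fun hh => lt_of_le_of_ne hh hne.symm⟩

variable [DecidableEq X]

instance (π : Equiv.Perm X) : DecidablePred (IsTransversal π) := fun S =>
  inferInstanceAs (Decidable (∀ h, h ∈ S ↔ π h ∉ S))

theorem IsTransversal.prod_compl {π : Equiv.Perm X} {S : Finset X} (hS : IsTransversal π S)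
    (hπ : ∀ h, π (π h) = h ∧ π h ≠ h) {R : Type*} [CommMonoid R] (k : X → R) :
    ∏ h ∈ Sᶜ, k h = ∏ h ∈ S, k (π h) := by
  refine Finset.prod_bij' (fun h _ => π h) (fun h _ => π h) (fun h hh => ?_) (fun h hh => ?_)
    (fun h _ => (hπ h).1) (fun h _ => (hπ h).1) (fun h _ => by rw [(hπ h).1])
  · rw [hS, (hπ h).1]; simpa using hh
  · simpa using (hS h).1 hh

theorem IsTransversal.prod_univ {π : Equiv.Perm X} {S : Finset X} (hS : IsTransversal π S)
    (hπ : ∀ h, π (π h) = h ∧ π h ≠ h) {R : Type*} [CommMonoid R] (k : X → R) :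
    ∏ h, k h = ∏ h ∈ S, k h * k (π h) := by
  rw [Finset.prod_mul_distrib, ← hS.prod_compl hπ, Finset.prod_mul_prod_compl]

theorem IsTransversal.card {π : Equiv.Perm X} {S : Finset X} (hS : IsTransversal π S)
    (hπ : ∀ h, π (π h) = h ∧ π h ≠ h) : Fintype.card X = 2 * S.card := by
  have h1 : Sᶜ.card = S.card :=
    Finset.card_bij' (fun h _ => π h) (fun h _ => π h)
      (fun h hh => by rw [hS, (hπ h).1]; simpa using hh) (fun h hh => by simpa using (hS h).1 hh)
      (fun h _ => (hπ h).1) (fun h _ => (hπ h).1)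
  have := Finset.card_add_card_compl S
  omega

/-- Sum over the transversals of a pairing as a product over its pairs. -/
theorem sum_isTransversal {π : Equiv.Perm X} (hπ : ∀ h, π (π h) = h ∧ π h ≠ h)
    {E : Finset X} (hE : IsTransversal π E) {R : Type*} [CommRing R] (f g : X → R) :
    ∑ S with IsTransversal π S, ∏ h, (if h ∈ S then f h else g h) =
      ∏ h ∈ E, (f h * g (π h) + g h * f (π h)) := by
  rw [Finset.prod_add]
  -- A transversal is determined by its trace `t` on the reference transversal `E`: it is `t ∪ π (E
  -- \ t)`.
  refine Finset.sum_bij' (fun S _ => S ∩ E)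
    (fun t _ => Finset.univ.filter fun h => if h ∈ E then h ∈ t else π h ∉ t)
    (fun S _ => by simp) (fun t ht => ?_) (fun S hS => ?_) (fun t ht => ?_) (fun S hS => ?_)
  · simp only [Finset.mem_filter, Finset.mem_univ, true_and]
    intro h
    have := hE h
    simp only [Finset.mem_filter, Finset.mem_univ, true_and, (hπ h).1]
    by_cases hh : h ∈ E <;> simp_all
  · simp only [Finset.mem_filter, Finset.mem_univ, true_and] at hS
    ext h
    have h1 := hE h
    have h2 := hS h
    simp only [Finset.mem_filter, Finset.mem_univ, true_and, Finset.mem_inter]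
    by_cases hh : h ∈ E <;> simp_all
  · ext h
    simp only [Finset.mem_powerset] at ht
    simp only [Finset.mem_filter, Finset.mem_univ, true_and, Finset.mem_inter]
    constructor
    · rintro ⟨h1, h2⟩
      simpa [h2] using h1
    · intro h1
      simp [h1, ht h1]
  · simp only [Finset.mem_filter, Finset.mem_univ, true_and] at hS
    rw [hE.prod_univ hπ, ← Finset.prod_sdiff (Finset.inter_subset_right (s₁ := S) (s₂ := E)), mul_comm]
    refine congrArg₂ _ (Finset.prod_congr rfl fun h hh => ?_) ?_
    · have h1 : h ∈ S := (Finset.mem_inter.1 hh).1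
      rw [if_pos h1, if_neg ((hS h).1 h1)]
    · refine Finset.prod_congr rfl fun h hh => ?_
      have h1 : h ∉ S := fun h' => (Finset.mem_sdiff.1 hh).2
        (Finset.mem_inter.2 ⟨h', (Finset.mem_sdiff.1 hh).1⟩)
      have h2 : π h ∈ S := by
        by_contra h'
        exact h1 ((hS h).2 h')
      rw [if_neg h1, if_pos h2]

/-- Conjugation by a permutation carrying `S` onto `T` is a bijection between the two families of
pairings. -/
theorem card_isTransversal_eq {S T : Finset X} (hST : S.card = T.card) :
    (Finset.univ.filter fun π : {π : Equiv.Perm X // ∀ h, π (π h) = h ∧ π h ≠ h} =>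
        IsTransversal π.1 S).card =
      (Finset.univ.filter fun π : {π : Equiv.Perm X // ∀ h, π (π h) = h ∧ π h ≠ h} =>
        IsTransversal π.1 T).card := by
  have e : {x // x ∈ S} ≃ {x // x ∈ T} := Fintype.equivOfCardEq (by simpa using hST)
  let g : Equiv.Perm X := e.extendSubtype
  have hg : ∀ x, g x ∈ T ↔ x ∈ S := fun x =>
    ⟨fun h => by_contra fun hx => e.extendSubtype_not_mem x hx h, fun h => e.extendSubtype_mem x h⟩
  have hg' : ∀ x, g.symm x ∈ S ↔ x ∈ T := fun x => by rw [← hg, Equiv.apply_symm_apply]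
  refine Finset.card_bij'
    (fun π _ => ⟨(g.symm.trans π.1).trans g, fun h => ⟨by simp [(π.2 (g.symm h)).1], fun hh =>
      (π.2 (g.symm h)).2 ((Equiv.eq_symm_apply g).2 hh)⟩⟩)
    (fun π _ => ⟨(g.trans π.1).trans g.symm, fun h => by
      simpa [(π.2 (g h)).1, Equiv.symm_apply_eq] using (π.2 (g h)).2⟩)
    (fun π hπ => ?_) (fun π hπ => ?_) (fun π _ => ?_) (fun π _ => ?_)
  · simp only [Finset.mem_filter, Finset.mem_univ, true_and] at hπ ⊢
    intro h
    simp only [Equiv.trans_apply, hg]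
    rw [← hπ, hg']
  · simp only [Finset.mem_filter, Finset.mem_univ, true_and] at hπ ⊢
    intro h
    simp only [Equiv.trans_apply, hg']
    rw [← hπ, hg]
  · ext; simp
  · ext; simp

/-- The average over all pairings of a product over pairs of symmetrized weights is an average
over all subsets of half the size. -/
theorem choose_mul_sum_pairing {M : ℕ} (hX : Fintype.card X = 2 * M) {f g : X → ℂ}
    {w : X → X → ℂ} (hw : ∀ x y, f x * g y + g x * f y = 2 * Complex.exp (w x y))
    (hsymm : ∀ x y, w x y = w y x) :
    ((2 * M).choose M : ℂ) * ∑ π : {π : Equiv.Perm X // ∀ h, π (π h) = h ∧ π h ≠ h},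
        Complex.exp (1 / 2 * ∑ h, w h (π.1 h)) =
      Fintype.card {π : Equiv.Perm X // ∀ h, π (π h) = h ∧ π h ≠ h} *
        ∑ S ∈ Finset.powersetCard M Finset.univ, ∏ h, (if h ∈ S then f h else g h) := by
  set P := {π : Equiv.Perm X // ∀ h, π (π h) = h ∧ π h ≠ h}
  obtain ⟨S₀, hS₀⟩ : ∃ S : Finset X, S.card = M := by
    obtain ⟨S, -, hS⟩ := Finset.exists_subset_card_eq (s := (Finset.univ : Finset X)) (n := M)
      (by rw [Finset.card_univ, hX]; omega)
    exact ⟨S, hS⟩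
  set κ := (Finset.univ.filter fun π : P => IsTransversal π.1 S₀).card with hκ
  -- Double counting of pairs (pairing, transversal): every set of size `M` is a transversal of the
  -- same number `κ` of pairings, and no other set is a transversal of any.
  have hdouble : ∀ F : Finset X → ℂ, ∑ π : P, ∑ S with IsTransversal π.1 S, F S =
      κ * ∑ S ∈ Finset.powersetCard M Finset.univ, F S := by
    intro F
    simp only [Finset.sum_filter]
    rw [Finset.sum_comm, Finset.mul_sum]
    symm
    refine Finset.sum_subset_zero_on_sdiff (Finset.subset_univ _) (fun S hS => ?_) (fun S hS => ?_)
    · refine Finset.sum_eq_zero fun π _ => if_neg fun hT => ?_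
      have := hT.card π.2
      simp at hS
      omega
    · rw [← Finset.sum_filter, Finset.sum_const, nsmul_eq_mul, hκ,
        card_isTransversal_eq (hS₀.trans (Finset.mem_powersetCard.1 hS).2.symm)]
  have hval : ∀ π : P, ∑ S with IsTransversal π.1 S, ∏ h, (if h ∈ S then f h else g h) =
      2 ^ M * Complex.exp (1 / 2 * ∑ h, w h (π.1 h)) := by
    intro π
    obtain ⟨E, hE⟩ := exists_isTransversal π.2
    have hEM : E.card = M := by have := hE.card π.2; omega
    rw [sum_isTransversal π.2 hE]
    simp only [hw]
    rw [Finset.prod_mul_distrib, Finset.prod_const, hEM, ← Complex.exp_sum]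
    -- The product formula over pairs, read additively through `Multiplicative`.
    have h1 : ∏ h, Multiplicative.ofAdd (w h (π.1 h)) =
      ∏ h ∈ E, Multiplicative.ofAdd (w h (π.1 h)) * Multiplicative.ofAdd (w (π.1 h) (π.1 (π.1 h))) :=
      hE.prod_univ π.2 _
    have h2 : ∑ h, w h (π.1 h) = ∑ h ∈ E, (w h (π.1 h) + w (π.1 h) (π.1 (π.1 h))) := h1
    have h3 : ∑ h, w h (π.1 h) = 2 * ∑ h ∈ E, w h (π.1 h) := by
      rw [h2, Finset.mul_sum]
      refine Finset.sum_congr rfl fun h _ => ?_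
      rw [(π.2 h).1, hsymm (π.1 h) h, two_mul]
    rw [h3]
    congr 2
    ring
  have h1 := hdouble fun S => ∏ h, (if h ∈ S then f h else g h)
  simp only [hval, ← Finset.mul_sum] at h1
  -- The double count with `F = 1` gives `2 ^ M` times the number of pairings as `κ` times the
  -- binomial coefficient, which eliminates `κ`.
  have hone : ∀ π : P, ∑ S with IsTransversal π.1 S, (1 : ℂ) = 2 ^ M := by
    intro π
    obtain ⟨E, hE⟩ := exists_isTransversal π.2
    have hEM : E.card = M := by have := hE.card π.2; omega
    have := sum_isTransversal π.2 hE (fun _ => (1 : ℂ)) (fun _ => 1)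
    simpa [hEM, one_add_one_eq_two] using this
  have h2 := hdouble fun _ => 1
  simp only [hone] at h2
  simp only [Finset.sum_const, nsmul_eq_mul, mul_one, Finset.card_univ, Finset.card_powersetCard,
    hX] at h2
  refine mul_left_cancel₀ (pow_ne_zero M (two_ne_zero (α := ℂ))) ?_
  linear_combination ((2 * M).choose M : ℂ) * h1 -
    (∑ S ∈ Finset.powersetCard M Finset.univ, ∏ h, (if h ∈ S then f h else g h)) * h2

end Transversal

/-! ### The annealed partition function as a polynomial coefficient. -/

open Polynomial in
theorem sum_powersetCard_eq_coeff {X R : Type*} [Fintype X] [DecidableEq X] [CommRing R] (M : ℕ)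
    (f g : X → R) :
    ∑ S ∈ Finset.powersetCard M Finset.univ, ∏ h, (if h ∈ S then f h else g h) =
      (∏ h, (C (f h) * Polynomial.X + C (g h))).coeff M := by
  have hprod : ∀ S : Finset X, ∏ h, (if h ∈ S then f h else g h) =
      (∏ h ∈ S, f h) * ∏ h ∈ Finset.univ \ S, g h := by
    intro S
    rw [Finset.prod_ite, Finset.filter_mem_eq_inter, Finset.univ_inter, Finset.filter_notMem_eq_sdiff]
  rw [Finset.prod_add, finsetSum_coeff, Finset.powerset_univ]
  refine Finset.sum_subset_zero_on_sdiff (Finset.subset_univ _) (fun S hS => ?_) (fun S hS => ?_)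
  · rw [Finset.prod_mul_distrib, ← map_prod, ← map_prod, Finset.prod_const, coeff_mul_C, coeff_C_mul,
      coeff_X_pow, if_neg, mul_zero, zero_mul]
    simp at hS
    exact fun h => hS h.symm
  · rw [Finset.prod_mul_distrib, ← map_prod, ← map_prod, Finset.prod_const, coeff_mul_C, coeff_C_mul,
      coeff_X_pow, if_pos (Finset.mem_powersetCard.1 hS).2.symm, mul_one, hprod]

open Polynomial in
/-- The generating polynomial of a vertex of degree `k` in the external field `z`. -/
noncomputable def vertexPoly (a b : ℤˣ → ℂ) (z : ℂ) (k : ℕ) : ℂ[X] :=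
  ∑ s : ℤˣ, C (Complex.exp (z * (s : ℤ))) * (C (a s) * X + C (b s)) ^ k

open Polynomial in
/-- The annealed partition function in a complex external field is a coefficient of the product
of the vertex polynomials. -/
theorem choose_mul_annealedPartition {β : ℝ} {a b : ℤˣ → ℂ}
    (hab : ∀ s t : ℤˣ, a s * b t + b s * a t = 2 * Complex.exp (β * ((s : ℤ) * (t : ℤ))))
    {N : ℕ} {d : Fin N → ℕ} {M : ℕ} (hM : ∑ i, d i = 2 * M) (z : ℂ) :
    ((2 * M).choose M : ℂ) * ∑ σ : Spins N, Complex.exp (z * totalSpin σ) *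
        (graphMean (fun π : Pairing d => Real.exp (β * edgeSum π σ)) : ℝ) =
      (∏ i, vertexPoly a b z (d i)).coeff M := by
  have hcard : Fintype.card (HalfEdge d) = 2 * M := by simp [hM]
  have hne : Nonempty (Pairing d) := nonempty_pairing ⟨M, by omega⟩
  have hP : (Fintype.card (Pairing d) : ℂ) ≠ 0 := by exact_mod_cast Fintype.card_ne_zero
  have hmean : ∀ σ : Spins N, ((2 * M).choose M : ℂ) *
      ((graphMean (fun π : Pairing d => Real.exp (β * edgeSum π σ)) : ℝ) : ℂ) =
      (∏ h : HalfEdge d, (C (a (σ h.1)) * X + C (b (σ h.1)))).coeff M := by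
    intro σ
    have h := choose_mul_sum_pairing hcard (f := fun h : HalfEdge d => a (σ h.1))
      (g := fun h => b (σ h.1)) (w := fun h k => β * ((σ h.1 : ℤ) * (σ k.1 : ℤ)))
      (fun x y => hab _ _) (fun x y => by ring)
    rw [sum_powersetCard_eq_coeff] at h
    rw [graphMean, Complex.ofReal_div, mul_div_assoc', div_eq_iff (by exact_mod_cast hP), mul_comm _ (_ : ℂ)]
    push_cast
    refine Eq.trans ?_ (h.trans (mul_comm _ _))
    rw [mul_comm]
    congr 1
    refine Finset.sum_congr rfl fun π _ => ?_
    rw [edgeSum]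
    congr 1
    simp only [spin]
    push_cast
    rw [← Finset.mul_sum]
    ring
  have hS : ∀ σ : Spins N, Complex.exp (z * totalSpin σ) =
      ∏ i, Complex.exp (z * ((σ i : ℤ) : ℂ)) := by
    intro σ
    rw [← Complex.exp_sum, ← Finset.mul_sum, totalSpin]
    simp [spin]
  rw [Finset.mul_sum]
  simp only [mul_left_comm _ (Complex.exp _), hmean, vertexPoly]
  rw [Finset.prod_univ_sum, Fintype.piFinset_univ, finsetSum_coeff]
  refine Finset.sum_congr rfl fun σ _ => ?_
  rw [← coeff_C_mul, hS, map_prod, Fintype.prod_sigma, ← Finset.prod_mul_distrib]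
  simp

theorem prod_eq_pow_mul_pow {N : ℕ} {d : Fin N → ℕ} (hd : ∀ i, d i = 1 ∨ d i = 2) {R : Type*}
    [CommMonoid R] (F : ℕ → R) :
    ∏ i, F (d i) = F 1 ^ (Finset.univ.filter fun i => d i = 1).card *
      F 2 ^ (Finset.univ.filter fun i => d i = 2).card := by
  rw [← Finset.prod_filter_mul_prod_filter_not Finset.univ (fun i => d i = 1)]
  congr 1
  · rw [← Finset.prod_const]
    exact Finset.prod_congr rfl fun i hi => by rw [(Finset.mem_filter.1 hi).2]
  · rw [← Finset.prod_const]
    refine Finset.prod_congr ?_ fun i hi => by rw [(Finset.mem_filter.1 hi).2]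
    ext i
    have := hd i
    simp only [Finset.mem_filter, Finset.mem_univ, true_and]
    omega

/-! ### Polynomials with roots in the open left half-plane. -/

section Hurwitz

open Polynomial

/-- A nonzero polynomial all of whose roots lie in the open left half-plane. -/
def IsHurwitz (P : ℂ[X]) : Prop := P ≠ 0 ∧ ∀ z : ℂ, P.eval z = 0 → z.re < 0

theorem IsHurwitz.mul {P Q : ℂ[X]} (hP : IsHurwitz P) (hQ : IsHurwitz Q) : IsHurwitz (P * Q) :=
  ⟨mul_ne_zero hP.1 hQ.1, fun z hz => by
    rw [eval_mul, mul_eq_zero] at hz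
    exact hz.elim (hP.2 z) (hQ.2 z)⟩

theorem IsHurwitz.pow {P : ℂ[X]} (hP : IsHurwitz P) (n : ℕ) : IsHurwitz (P ^ n) :=
  ⟨pow_ne_zero n hP.1, fun z hz => hP.2 z (eq_zero_of_pow_eq_zero (by rwa [eval_pow] at hz))⟩

/-- At the root `z = -v / u` one has `Re (v ū) = -|u|² Re z`. Positivity of this real part is an
open condition on `(u, v)`, which is why the criterion takes this form. -/
theorem isHurwitz_linear {u v : ℂ} (h : 0 < (v * (starRingEnd ℂ) u).re) :
    IsHurwitz (C u * X + C v) ∧ (C u * X + C v).natDegree = 1 := by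
  have hu : u ≠ 0 := by rintro rfl; simp at h
  have hdeg : (C u * X + C v).natDegree = 1 := natDegree_linear hu
  refine ⟨⟨fun h0 => by simp [h0] at hdeg, fun z hz => ?_⟩, hdeg⟩
  have hz' : v = -(u * z) := by
    simp only [eval_add, eval_mul, eval_C, eval_X] at hz
    linear_combination hz
  have h2 : (v * (starRingEnd ℂ) u).re = -(Complex.normSq u * z.re) := by
    rw [hz']
    simp only [Complex.mul_re, Complex.neg_re, Complex.neg_im, Complex.mul_im, Complex.conj_re,
      Complex.conj_im, Complex.normSq_apply]
    ring
  rw [h2] at h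
  by_contra hneg
  nlinarith [mul_nonneg (Complex.normSq_nonneg u) (not_lt.1 hneg)]

/-- Gauss–Lucas: the critical points lie in the convex hull of the roots, and the half-plane is
convex. -/
theorem IsHurwitz.derivative {P : ℂ[X]} (hP : IsHurwitz P) (hdeg : 0 < P.natDegree) :
    IsHurwitz (Polynomial.derivative P) := by
  have hne : Polynomial.derivative P ≠ 0 := fun h =>
    hdeg.ne' (derivative_eq_zero.1 h)
  refine ⟨hne, fun z hz => ?_⟩
  have hmem := rootSet_derivative_subset_convexHull_rootSet (natDegree_pos_iff_degree_pos.1 hdeg)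
    (show z ∈ (Polynomial.derivative P).rootSet ℂ by
      rw [mem_rootSet]; exact ⟨hne, by simpa using hz⟩)
  have hconv : Convex ℝ {z : ℂ | z.re < 0} := convex_halfSpace_re_lt 0
  refine convexHull_min (fun w hw => ?_) hconv hmem
  rw [mem_rootSet] at hw
  exact hP.2 w (by simpa using hw.2)

/-- Up to a factorial, the `k`-th coefficient is the `k`-th derivative at `0`; that derivative is
again Hurwitz, and `0` is not in the open left half-plane. -/
theorem IsHurwitz.coeff_ne_zero {P : ℂ[X]} (hP : IsHurwitz P) {k : ℕ} (hk : k ≤ P.natDegree) :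
    P.coeff k ≠ 0 := by
  induction k generalizing P with
  | zero =>
    rw [coeff_zero_eq_eval_zero]
    exact fun h => by simpa using hP.2 0 h
  | succ k ih =>
    have := ih (hP.derivative (by omega)) (by rw [natDegree_derivative]; omega)
    rw [coeff_derivative] at this
    exact left_ne_zero_of_mul this

end Hurwitz

/-! ### A zero-free disc uniform in the size. -/

/-- A complex half-edge amplitude whose real symmetrization is the Ising edge weight. -/
noncomputable def amplitude (β : ℝ) : ℂ := ⟨√(Real.cosh β), √(Real.sinh β)⟩

theorem amplitude_mul_conj {β : ℝ} (hβ : 0 < β) :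
    amplitude β * (starRingEnd ℂ) (amplitude β) = Real.exp β := by
  rw [Complex.mul_conj, amplitude, Complex.normSq_mk, Real.mul_self_sqrt (Real.cosh_pos β).le,
    Real.mul_self_sqrt (Real.sinh_pos_iff.2 hβ).le, Real.cosh_add_sinh]

theorem amplitude_sq_add_conj_sq {β : ℝ} (hβ : 0 < β) :
    amplitude β ^ 2 + (starRingEnd ℂ) (amplitude β) ^ 2 = 2 * Real.exp (-β) := by
  have h1 := Real.sq_sqrt (Real.cosh_pos β).le
  have h2 := Real.sq_sqrt (Real.sinh_pos_iff.2 hβ).le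
  have h3 : Real.exp (-β) = √(Real.cosh β) ^ 2 - √(Real.sinh β) ^ 2 := by
    rw [h1, h2, Real.cosh_sub_sinh]
  have h4 : amplitude β = (√(Real.cosh β) : ℂ) + (√(Real.sinh β) : ℂ) * Complex.I :=
    Complex.mk_eq_add_mul_I _ _
  have h5 : (starRingEnd ℂ) (amplitude β) =
      (√(Real.cosh β) : ℂ) - (√(Real.sinh β) : ℂ) * Complex.I := by
    rw [h4]
    simp [sub_eq_add_neg]
  rw [h5, h4, h3]
  push_cast
  linear_combination (2 * (√(Real.sinh β) : ℂ) ^ 2) * Complex.I_sq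

theorem sum_units_int {R : Type*} [AddCommMonoid R] (f : ℤˣ → R) : ∑ s : ℤˣ, f s = f 1 + f (-1) := by
  rw [show (Finset.univ : Finset ℤˣ) = {1, -1} by decide, Finset.sum_pair (by decide)]

open Polynomial in
/-- The annealed partition function does not vanish in a complex neighbourhood, independent of the
size and of the degree sequence, of any real field. -/
theorem exists_forall_annealedPartition_ne_zero {β : ℝ} (hβ : 0 < β) (B : ℝ) :
    ∃ δ > 0, ∀ (N : ℕ) (d : Fin N → ℕ), (∀ i, d i = 1 ∨ d i = 2) → Even (∑ i, d i) →
      ∀ z ∈ Metric.ball (B : ℂ) δ, ∑ σ : Spins N, Complex.exp (z * totalSpin σ) *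
        (graphMean (fun π : Pairing d => Real.exp (β * edgeSum π σ)) : ℝ) ≠ 0 := by
  set α := amplitude β with hα
  set α' := (starRingEnd ℂ) α with hα'
  have h1 : α * α' = Real.exp β := amplitude_mul_conj hβ
  have h2 : α ^ 2 + α' ^ 2 = 2 * Real.exp (-β) := amplitude_sq_add_conj_sq hβ
  have hre : α.re ^ 2 = Real.cosh β := Real.sq_sqrt (Real.cosh_pos β).le
  have him : α.im ^ 2 = Real.sinh β := Real.sq_sqrt (Real.sinh_pos_iff.2 hβ).le
  have hsinh := Real.sinh_pos_iff.2 hβ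
  have hlt : Real.sinh β < Real.cosh β := Real.sinh_lt_cosh β
  -- Leading and constant coefficients of the linear factors. The degree-two vertex polynomial is
  -- `p² + q² = (p + iq)(p - iq)` with `p = e^{z/2}(αX + α')` and `q = e^{-z/2}(α'X + α)`; `ε = ±i`
  -- selects the factor.
  let f₁ : ℂ → ℂ × ℂ := fun z =>
    (Complex.exp z * α + Complex.exp (-z) * α', Complex.exp z * α' + Complex.exp (-z) * α)
  let f₂ : ℂ → ℂ → ℂ × ℂ := fun ε z =>
    (Complex.exp (z / 2) * α + ε * Complex.exp (-z / 2) * α',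
      Complex.exp (z / 2) * α' + ε * Complex.exp (-z / 2) * α)
  -- By continuity the half-plane condition need only be checked at the real field `B`.
  have hc : ∀ f : ℂ → ℂ × ℂ, Continuous f → 0 < ((f B).2 * (starRingEnd ℂ) (f B).1).re →
      ∀ᶠ z in 𝓝 (B : ℂ), 0 < ((f z).2 * (starRingEnd ℂ) (f z).1).re := by
    intro f hf h0
    refine Tendsto.eventually_const_lt h0 (Continuous.tendsto ?_ _)
    fun_prop
  have e₁ := hc f₁ (by fun_prop) (by
    simp only [f₁, ← Complex.ofReal_neg, ← Complex.ofReal_exp, hα']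
    simp only [Complex.mul_re, Complex.add_re, Complex.add_im, Complex.mul_im, Complex.conj_re,
      Complex.conj_im, Complex.ofReal_re, Complex.ofReal_im, map_add, map_mul]
    have hp := Real.exp_pos B
    have hq := Real.exp_pos (-B)
    -- At real field the two coefficients are complex conjugates, so the quantity is the real part
    -- of a square. It is positive because `(Re α)² = cosh β > sinh β = (Im α)²`.
    have : 0 < (Real.exp B + Real.exp (-B)) ^ 2 * α.re ^ 2
        - (Real.exp B - Real.exp (-B)) ^ 2 * α.im ^ 2 := by
      rw [hre, him]
      nlinarith [mul_pos hp hq, mul_pos (mul_pos hp hq) hsinh,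
        mul_pos (pow_pos (add_pos hp hq) 2) (sub_pos.2 hlt)]
    nlinarith [this])
  have e₂ : ∀ ε : ℂ, ε = Complex.I ∨ ε = -Complex.I →
      ∀ᶠ z in 𝓝 (B : ℂ), 0 < ((f₂ ε z).2 * (starRingEnd ℂ) (f₂ ε z).1).re := by
    intro ε hε
    refine hc (f₂ ε) (by fun_prop) ?_
    have hB : (-(B : ℂ) / 2) = ((-B / 2 : ℝ) : ℂ) := by push_cast; ring
    have hB' : ((B : ℂ) / 2) = ((B / 2 : ℝ) : ℂ) := by push_cast; ring
    simp only [f₂, hB, hB', ← Complex.ofReal_exp, hα']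
    have hp := pow_pos (Real.exp_pos (B / 2)) 2
    have hq := pow_pos (Real.exp_pos (-B / 2)) 2
    -- As `ε + ε̄ = 0`, the mixed terms cancel and only `Re (α²) = cosh β - sinh β` remains.
    have : 0 < (Real.exp (B / 2) ^ 2 + Real.exp (-B / 2) ^ 2) * (α.re ^ 2 - α.im ^ 2) := by
      rw [hre, him]
      exact mul_pos (add_pos hp hq) (sub_pos.2 hlt)
    rcases hε with rfl | rfl
    all_goals
      simp only [Complex.mul_re, Complex.add_re, Complex.add_im, Complex.mul_im, Complex.conj_re,
        Complex.conj_im, Complex.ofReal_re, Complex.ofReal_im, map_add, map_mul, Complex.I_re,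
        Complex.I_im, Complex.neg_re, Complex.neg_im]
      nlinarith [this]
  obtain ⟨δ, hδ, hball⟩ := Metric.eventually_nhds_iff_ball.1
    (e₁.and ((e₂ _ (Or.inl rfl)).and (e₂ _ (Or.inr rfl))))
  refine ⟨δ, hδ, fun N d hd hev z hz h0 => ?_⟩
  obtain ⟨hz₁, hz₂, hz₃⟩ := hball z hz
  obtain ⟨M, hM⟩ := hev
  have hM' : ∑ i, d i = 2 * M := by omega
  let a : ℤˣ → ℂ := fun s => if s = 1 then α else α'
  let b : ℤˣ → ℂ := fun s => if s = 1 then α' else α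
  have hab : ∀ s t : ℤˣ, a s * b t + b s * a t = 2 * Complex.exp (β * ((s : ℤ) * (t : ℤ))) := by
    have hne : (-1 : ℤˣ) ≠ 1 := by decide
    intro s t
    rcases Int.units_eq_one_or s with rfl | rfl <;> rcases Int.units_eq_one_or t with rfl | rfl <;>
      simp only [a, b, if_true, if_neg hne] <;> push_cast at h1 h2 ⊢
    · simp only [mul_one]; linear_combination 2 * h1
    · simp only [mul_neg, mul_one]; linear_combination h2
    · simp only [mul_neg, mul_one]; linear_combination h2
    · simp only [mul_neg, mul_one, neg_neg]; linear_combination 2 * h1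
  have hne : (-1 : ℤˣ) ≠ 1 := by decide
  have hv1 : vertexPoly a b z 1 = C (f₁ z).1 * X + C (f₁ z).2 := by
    simp only [vertexPoly, sum_units_int, a, b, if_true, if_neg hne, f₁]
    push_cast
    simp only [C_add, C_mul, mul_one, mul_neg]
    ring
  have hexp : ∀ w : ℂ, Complex.exp w = Complex.exp (w / 2) ^ 2 := by
    intro w
    rw [← Complex.exp_nat_mul]
    congr 1
    push_cast
    ring
  have hI : (C Complex.I : ℂ[X]) ^ 2 = -1 := by
    rw [← C_pow, Complex.I_sq, C_neg, C_1]
  have hv2 : vertexPoly a b z 2 = (C (f₂ Complex.I z).1 * X + C (f₂ Complex.I z).2) *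
      (C (f₂ (-Complex.I) z).1 * X + C (f₂ (-Complex.I) z).2) := by
    simp only [vertexPoly, sum_units_int, a, b, if_true, if_neg hne, f₂]
    push_cast
    simp only [mul_one, mul_neg]
    rw [hexp z, hexp (-z)]
    simp only [C_add, C_mul, C_pow, C_neg]
    linear_combination ((C (Complex.exp (-z / 2)) ^ 2 * (C α' * X + C α) ^ 2)) * hI
  obtain ⟨g₁, n₁⟩ := isHurwitz_linear hz₁
  obtain ⟨g₂, n₂⟩ := isHurwitz_linear hz₂
  obtain ⟨g₃, n₃⟩ := isHurwitz_linear hz₃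
  have hmain := choose_mul_annealedPartition hab hM' z
  rw [h0, mul_zero, prod_eq_pow_mul_pow hd, hv1, hv2] at hmain
  have hsumd : ∑ i, d i = (Finset.univ.filter fun i => d i = 1).card +
      (Finset.univ.filter fun i => d i = 2).card * 2 := by
    have := prod_eq_pow_mul_pow hd (R := Multiplicative ℕ) Multiplicative.ofAdd
    have h := congrArg Multiplicative.toAdd this
    simpa using h
  -- A zero of the partition function would be a vanishing middle coefficient of a Hurwitz
  -- polynomial of degree `2 * M`.
  refine ((g₁.pow _).mul ((g₂.mul g₃).pow _)).coeff_ne_zero ?_ hmain.symm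
  rw [natDegree_mul (g₁.pow _).1 ((g₂.mul g₃).pow _).1, natDegree_pow, natDegree_pow,
    natDegree_mul g₂.1 g₃.1, n₁, n₂, n₃]
  omega

/-! ### Middle coefficients of products of powers of `1 + X` and `1 - X`. -/

section Krawtchouk

open Polynomial

/-- From `(1 + X)² - (1 - X)² = 4X`. This recursion trades a factor `(1 - X)²` for `(1 + X)²` and
drives both inductions on `k` below. -/
theorem coeff_mul_one_add_sq_sub (P : ℂ[X]) (n : ℕ) :
    (P * (1 + X) ^ 2).coeff (n + 1) - (P * (1 - X) ^ 2).coeff (n + 1) = 4 * P.coeff n := by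
  rw [← coeff_sub, show P * (1 + X) ^ 2 - P * (1 - X) ^ 2 = C 4 * P * X by
    rw [show (C 4 : ℂ[X]) = 4 from rfl]; ring, coeff_mul_X, coeff_C_mul]

/-- Conceptually, reversing the coefficients changes the sign of an odd power of `1 - X`, so the
middle coefficient is its own negative. -/
theorem coeff_central_odd (j k : ℕ) :
    ((1 + X : ℂ[X]) ^ (2 * j + 1) * (1 - X) ^ (2 * k + 1)).coeff (j + k + 1) = 0 := by
  induction k generalizing j with
  | zero =>
    rw [show (1 + X : ℂ[X]) ^ (2 * j + 1) * (1 - X) ^ (2 * 0 + 1) =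
      (1 + X) ^ (2 * j + 1) - (1 + X) ^ (2 * j + 1) * X by ring, coeff_sub, add_zero, coeff_mul_X,
      coeff_one_add_X_pow, coeff_one_add_X_pow, Nat.choose_symm_half, sub_self]
  | succ k ih =>
    have h := coeff_mul_one_add_sq_sub ((1 + X : ℂ[X]) ^ (2 * j + 1) * (1 - X) ^ (2 * k + 1))
      (j + k + 1)
    rw [ih j, mul_zero, sub_eq_zero] at h
    have h2 := ih (j + 1)
    rw [show (1 + X : ℂ[X]) ^ (2 * (j + 1) + 1) * (1 - X) ^ (2 * k + 1) =
      (1 + X) ^ (2 * j + 1) * (1 - X) ^ (2 * k + 1) * (1 + X) ^ 2 by ring,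
      show j + 1 + k + 1 = j + k + 1 + 1 by ring, h] at h2
    rw [← h2]
    congr 1
    ring

theorem coeff_central_even (j k : ℕ) :
    ((1 + X : ℂ[X]) ^ (2 * j) * (1 - X) ^ (2 * k)).coeff (j + k) *
        ((j.factorial : ℂ) * k.factorial * (j + k).factorial) =
      (-1) ^ k * (((2 * j).factorial : ℂ) * (2 * k).factorial) := by
  induction k generalizing j with
  | zero =>
    have h := Nat.choose_mul_factorial_mul_factorial (show j ≤ 2 * j by omega)
    rw [show 2 * j - j = j by omega] at h
    have h' := congrArg (Nat.cast : ℕ → ℂ) h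
    push_cast at h'
    simp only [mul_zero, pow_zero, mul_one, add_zero, Nat.factorial_zero, Nat.cast_one, one_mul,
      coeff_one_add_X_pow]
    rw [← h']
    ring
  | succ k ih =>
    have h := coeff_mul_one_add_sq_sub ((1 + X : ℂ[X]) ^ (2 * j) * (1 - X) ^ (2 * k)) (j + k)
    have h1 := ih j
    have h2 := ih (j + 1)
    rw [show (1 + X : ℂ[X]) ^ (2 * (j + 1)) * (1 - X) ^ (2 * k) =
      (1 + X) ^ (2 * j) * (1 - X) ^ (2 * k) * (1 + X) ^ 2 by ring,
      show j + 1 + k = j + k + 1 by ring] at h2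
    rw [show (1 + X : ℂ[X]) ^ (2 * j) * (1 - X) ^ (2 * (k + 1)) =
      (1 + X) ^ (2 * j) * (1 - X) ^ (2 * k) * (1 - X) ^ 2 by ring,
      show j + (k + 1) = j + k + 1 by ring]
    set P := (1 + X : ℂ[X]) ^ (2 * j) * (1 - X) ^ (2 * k)
    rw [show 2 * (j + 1) = 2 * j + 1 + 1 by ring] at h2
    rw [show 2 * (k + 1) = 2 * k + 1 + 1 by ring]
    simp only [Nat.factorial_succ, Nat.cast_mul, Nat.cast_add, Nat.cast_one, Nat.cast_ofNat] at h2 ⊢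
    have hj : (j : ℂ) + 1 ≠ 0 := Nat.cast_add_one_ne_zero j
    refine mul_left_cancel₀ hj ?_
    linear_combination ((k : ℂ) + 1) * h2 -
      ((j : ℂ) + 1) * (k + 1) * (j.factorial * k.factorial * ((j + k + 1) * (j + k).factorial)) * h -
      4 * ((j : ℂ) + 1) * (k + 1) * (j + k + 1) * h1

end Krawtchouk

/-- The ratio `(2j-1)!! (2k-1)!! / (2(j+k)-1)!!`: the probability that a uniform pairing of
`2j + 2k` points splits into pairings of the first `2j` and of the last `2k` points. -/
noncomputable def pairRatio (j k : ℕ) : ℝ :=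
  ((2 * j).factorial * (2 * k).factorial * (j + k).factorial) /
    (j.factorial * k.factorial * (2 * (j + k)).factorial)

open Polynomial in
theorem coeff_central_eq_pairRatio (j k : ℕ) :
    ((1 + X : ℂ[X]) ^ (2 * j) * (1 - X) ^ (2 * k)).coeff (j + k) =
      (-1) ^ k * (((2 * (j + k)).choose (j + k) * pairRatio j k : ℝ) : ℂ) := by
  have h := coeff_central_even j k
  have hc : ((2 * (j + k)).choose (j + k) : ℝ) * ((j + k).factorial * (j + k).factorial) =
      (2 * (j + k)).factorial := by
    have h := Nat.choose_mul_factorial_mul_factorial (show j + k ≤ 2 * (j + k) by omega)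
    rw [show 2 * (j + k) - (j + k) = j + k by omega] at h
    rw [← h]
    push_cast
    ring
  have hf : ∀ n : ℕ, (n.factorial : ℝ) ≠ 0 := fun n => by positivity
  have hf' : ∀ n : ℕ, (n.factorial : ℂ) ≠ 0 := fun n => by exact_mod_cast hf n
  have hr : ((2 * (j + k)).choose (j + k) : ℝ) * pairRatio j k =
      ((2 * j).factorial * (2 * k).factorial) / (j.factorial * k.factorial * (j + k).factorial) := by
    rw [pairRatio, ← hc]
    have hch : ((2 * (j + k)).choose (j + k) : ℝ) ≠ 0 := by
      exact_mod_cast (Nat.choose_pos (by omega)).ne'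
    have := hf j
    have := hf k
    have := hf (j + k)
    field_simp
  rw [hr]
  push_cast
  rw [← mul_div_assoc, eq_div_iff (by have := hf' j; have := hf' k; have := hf' (j + k); positivity), h]

theorem pairRatio_pos (j k : ℕ) : 0 < pairRatio j k := by unfold pairRatio; positivity

theorem sum_range_two_mul_add_one {R : Type*} [AddCommMonoid R] (f : ℕ → R)
    (hf : ∀ k, f (2 * k + 1) = 0) (m : ℕ) :
    ∑ j ∈ Finset.range (2 * m + 1), f j = ∑ s ∈ Finset.range (m + 1), f (2 * s) := by
  induction m with
  | zero => simp
  | succ m ih =>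
    rw [show 2 * (m + 1) + 1 = 2 * m + 1 + 1 + 1 by ring, Finset.sum_range_succ,
      Finset.sum_range_succ, ih, hf, add_zero, Finset.sum_range_succ _ (m + 1)]
    rfl

open Polynomial in
/-- Expansion of the central coefficient of a product of diagonal linear and quadratic forms. -/
theorem coeff_central_diagonal (u v l₁ l₂ : ℝ) (m n : ℕ) :
    (((C (u : ℂ) * (1 + X) - C (Complex.I * v) * (1 - X)) ^ (2 * m) *
        (C (l₁ : ℂ) * (1 + X) ^ 2 - C (l₂ : ℂ) * (1 - X) ^ 2) ^ n : ℂ[X])).coeff (m + n) =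
      (((2 * (m + n)).choose (m + n) *
        ∑ s ∈ Finset.range (m + 1), ∑ k ∈ Finset.range (n + 1),
          (2 * m).choose (2 * s) * n.choose k * ((u ^ 2) ^ (m - s) * (v ^ 2) ^ s) *
            (l₁ ^ (n - k) * l₂ ^ k) * pairRatio (m - s + (n - k)) (s + k) : ℝ) : ℂ) := by
  have hexp : (C (u : ℂ) * (1 + X) - C (Complex.I * v) * (1 - X)) ^ (2 * m) *
      (C (l₁ : ℂ) * (1 + X) ^ 2 - C (l₂ : ℂ) * (1 - X) ^ 2) ^ n =
      ∑ j ∈ Finset.range (2 * m + 1), ∑ k ∈ Finset.range (n + 1),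
        C ((2 * m).choose j * n.choose k * (u ^ (2 * m - j) * (-(Complex.I * v)) ^ j) *
          (l₁ ^ (n - k) * (-l₂) ^ k) : ℂ) *
          ((1 + X) ^ (2 * m - j + 2 * (n - k)) * (1 - X) ^ (j + 2 * k)) := by
    rw [show C (u : ℂ) * (1 + X) - C (Complex.I * v) * (1 - X) =
        C (-(Complex.I * v)) * (1 - X) + C (u : ℂ) * (1 + X) by rw [C_neg]; ring,
      show C (l₁ : ℂ) * (1 + X) ^ 2 - C (l₂ : ℂ) * (1 - X) ^ 2 =
        C (-(l₂ : ℂ)) * (1 - X) ^ 2 + C (l₁ : ℂ) * (1 + X) ^ 2 by rw [C_neg]; ring,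
      add_pow, add_pow, Finset.sum_mul_sum]
    refine Finset.sum_congr rfl fun j _ => Finset.sum_congr rfl fun k _ => ?_
    simp only [C_mul, C_pow, map_natCast, mul_pow, pow_add, pow_mul]
    ring
  rw [hexp, finsetSum_coeff, sum_range_two_mul_add_one, Complex.ofReal_mul, Complex.ofReal_sum,
    Finset.mul_sum]
  · refine Finset.sum_congr rfl fun s hs => ?_
    rw [finsetSum_coeff, Complex.ofReal_sum, Finset.mul_sum]
    refine Finset.sum_congr rfl fun k hk => ?_
    have hs' : s ≤ m := by simpa [Nat.lt_succ_iff] using hs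
    have hk' : k ≤ n := by simpa [Nat.lt_succ_iff] using hk
    have h := coeff_central_eq_pairRatio (m - s + (n - k)) (s + k)
    rw [show m - s + (n - k) + (s + k) = m + n by omega] at h
    rw [coeff_C_mul, show 2 * m - 2 * s + 2 * (n - k) = 2 * (m - s + (n - k)) by omega,
      show 2 * s + 2 * k = 2 * (s + k) by ring, h, show 2 * m - 2 * s = 2 * (m - s) by omega,
      pow_mul, pow_mul, show (-(Complex.I * v)) ^ 2 = -((v : ℂ) ^ 2) by
        rw [neg_sq, mul_pow, Complex.I_sq]; ring, neg_pow ((v : ℂ) ^ 2), neg_pow (l₂ : ℂ)]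
    push_cast
    -- Signs: `(-iv)^{2s}` gives `(-1)^s`, `(-l₂)^k` gives `(-1)^k`, and the middle coefficient
    -- gives `(-1)^{s+k}`. They cancel, so the terms of the expansion are nonnegative when `l₁` and
    -- `l₂` are.
    have h1 : ((-1 : ℂ) ^ s) ^ 2 = 1 := by rw [← pow_mul, mul_comm, pow_mul]; norm_num
    have h2 : ((-1 : ℂ) ^ k) ^ 2 = 1 := by rw [← pow_mul, mul_comm, pow_mul]; norm_num
    rw [pow_add (-1 : ℂ) s k]
    generalize (-1 : ℂ) ^ s = e₁ at h1 ⊢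
    generalize (-1 : ℂ) ^ k = e₂ at h2 ⊢
    linear_combination (((2 * m).choose (2 * s) * n.choose k * (((u : ℂ) ^ 2) ^ (m - s) *
      ((v : ℂ) ^ 2) ^ s) * ((l₁ : ℂ) ^ (n - k) * (l₂ : ℂ) ^ k) *
      ((2 * (m + n)).choose (m + n) * pairRatio (m - s + (n - k)) (s + k)))) * (h1 * e₂ ^ 2 + h2)
  · intro s
    rw [finsetSum_coeff]
    refine Finset.sum_eq_zero fun k hk => ?_
    have hk' : k ≤ n := by simpa [Nat.lt_succ_iff] using hk
    rw [coeff_C_mul]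
    by_cases hs : 2 * s + 1 ≤ 2 * m
    · have h := coeff_central_odd (m - s - 1 + (n - k)) (s + k)
      rw [show m - s - 1 + (n - k) + (s + k) + 1 = m + n by omega] at h
      rw [show 2 * m - (2 * s + 1) + 2 * (n - k) = 2 * (m - s - 1 + (n - k)) + 1 by omega,
        show 2 * s + 1 + 2 * k = 2 * (s + k) + 1 by ring, h, mul_zero]
    · rw [Nat.choose_eq_zero_of_lt (by omega)]
      simp

/-! ### Spectral data of the transfer matrix. -/

section Eigen

variable (β B : ℝ)

/-- The second coordinate of the leading eigenvector of the transfer matrix. -/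
noncomputable def eigenGap : ℝ := lambdaPlus β B - Real.exp (β + B)

theorem eigenGap_eq : eigenGap β B =
    Real.exp β * (√(Real.sinh B ^ 2 + Real.exp (-4 * β)) - Real.sinh B) := by
  rw [eigenGap, lambdaPlus, Real.exp_add, ← Real.cosh_add_sinh B]
  ring

theorem eigenGap_pos : 0 < eigenGap β B := by
  rw [eigenGap_eq]
  refine mul_pos (Real.exp_pos _) (sub_pos.2 ((le_abs_self _).trans_lt ?_))
  rw [← Real.sqrt_sq_eq_abs]
  exact Real.sqrt_lt_sqrt (sq_nonneg _) (by linarith [Real.exp_pos (-4 * β)])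

theorem lambdaPlus_eq : lambdaPlus β B = Real.exp (β + B) + eigenGap β B := by
  rw [eigenGap]; ring

theorem lambdaMinus_eq : lambdaMinus β B = Real.exp (β - B) - eigenGap β B := by
  rw [eigenGap_eq, lambdaMinus, sub_eq_add_neg β, Real.exp_add, ← Real.cosh_sub_sinh B]
  ring

/-- The second row of the eigenvector equation for `(e^{-β}, eigenGap)`, the first row being the
definition of `eigenGap`. -/
theorem eigenGap_quadratic :
    eigenGap β B ^ 2 + (Real.exp (β + B) - Real.exp (β - B)) * eigenGap β B =
      Real.exp (-β) ^ 2 := by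
  have h1 := Real.sq_sqrt (show 0 ≤ Real.sinh B ^ 2 + Real.exp (-4 * β) by positivity)
  have h2 : Real.exp (β + B) - Real.exp (β - B) = 2 * Real.exp β * Real.sinh B := by
    rw [sub_eq_add_neg β, Real.exp_add, Real.exp_add, Real.sinh_eq]; ring
  have h3 : Real.exp β ^ 2 * Real.exp (-4 * β) = Real.exp (-β) ^ 2 := by
    rw [← Real.exp_nat_mul, ← Real.exp_nat_mul, ← Real.exp_add]; congr 1; push_cast; ring
  rw [h2, eigenGap_eq, ← h3]
  linear_combination Real.exp β ^ 2 * h1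

theorem lambdaPlus_pos : 0 < lambdaPlus β B := by
  rw [lambdaPlus_eq]
  exact add_pos (Real.exp_pos _) (eigenGap_pos β B)

theorem lambdaPlus_mul_lambdaMinus :
    lambdaPlus β B * lambdaMinus β B = Real.exp β ^ 2 - Real.exp (-β) ^ 2 := by
  have h : Real.exp (β + B) * Real.exp (β - B) = Real.exp β ^ 2 := by
    rw [← Real.exp_add, ← Real.exp_nat_mul]; congr 1; push_cast; ring
  rw [lambdaPlus_eq, lambdaMinus_eq]
  linear_combination h - eigenGap_quadratic β B

variable {β}

theorem lambdaMinus_pos (hβ : 0 < β) : 0 < lambdaMinus β B := by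
  refine pos_of_mul_pos_right ?_ (lambdaPlus_pos β B).le
  rw [lambdaPlus_mul_lambdaMinus, sub_pos]
  exact pow_lt_pow_left₀ (Real.exp_lt_exp.2 (by linarith)) (Real.exp_pos _).le two_ne_zero

theorem lambdaMinus_lt_lambdaPlus : lambdaMinus β B < lambdaPlus β B := by
  unfold lambdaMinus lambdaPlus
  have : 0 < √(Real.sinh B ^ 2 + Real.exp (-4 * β)) := by positivity
  gcongr
  linarith

variable (β)

/-- The squared norm of the leading eigenvector. -/
noncomputable def eigenNormSq : ℝ := Real.exp (-β) ^ 2 + eigenGap β B ^ 2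

theorem eigenNormSq_pos : 0 < eigenNormSq β B := by unfold eigenNormSq; positivity

/-- The squared inner product of the endpoint vector `(e^{B/2}, e^{-B/2})` with the normalized
leading eigenvector, times `λ₊`. This form shows positivity; `AMinus_mul_sq` is its analogue for the
orthogonal eigenvector `(-eigenGap, e^{-β})`. -/
theorem APlus_mul_sq : APlus β B * lambdaPlus β B ^ 2 = lambdaPlus β B *
    (Real.exp (B / 2) * Real.exp (-β) + Real.exp (-B / 2) * eigenGap β B) ^ 2 / eigenNormSq β B := by
  have h2 : Real.exp (-2 * β) = Real.exp (-β) ^ 2 := by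
    rw [← Real.exp_nat_mul]; congr 1; push_cast; ring
  have h3 : Real.exp B = Real.exp (B / 2) ^ 2 := by
    rw [← Real.exp_nat_mul]; congr 1; push_cast; ring
  have h4 : Real.exp (-B) = Real.exp (-B / 2) ^ 2 := by
    rw [← Real.exp_nat_mul]; congr 1; push_cast; ring
  have h5 : Real.exp (B / 2) * Real.exp (-B / 2) = 1 := by
    rw [← Real.exp_add, show B / 2 + -B / 2 = 0 by ring, Real.exp_zero]
  have hn := (eigenNormSq_pos β B).ne'
  have hl := (lambdaPlus_pos β B).ne'
  rw [APlus, ← eigenGap, h2, ← eigenNormSq, h3, h4]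
  generalize Real.exp (-B / 2) = E' at h5 ⊢
  field_simp
  linear_combination (-2 * Real.exp (-β) * eigenGap β B) * h5

variable {β} in
theorem AMinus_mul_sq (hβ : 0 < β) : AMinus β B * lambdaMinus β B ^ 2 = lambdaMinus β B *
    (Real.exp (-B / 2) * Real.exp (-β) - Real.exp (B / 2) * eigenGap β B) ^ 2 / eigenNormSq β B := by
  have h2 : Real.exp (-2 * β) = Real.exp (-β) ^ 2 := by
    rw [← Real.exp_nat_mul]; congr 1; push_cast; ring
  have h3 : Real.exp B = Real.exp (B / 2) ^ 2 := by
    rw [← Real.exp_nat_mul]; congr 1; push_cast; ring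
  have h4 : Real.exp (-B) = Real.exp (-B / 2) ^ 2 := by
    rw [← Real.exp_nat_mul]; congr 1; push_cast; ring
  have h5 : Real.exp (B / 2) * Real.exp (-B / 2) = 1 := by
    rw [← Real.exp_add, show B / 2 + -B / 2 = 0 by ring, Real.exp_zero]
  have hn := (eigenNormSq_pos β B).ne'
  have hl := (lambdaMinus_pos B hβ).ne'
  rw [AMinus, ← eigenGap, h2, ← eigenNormSq, h3, h4]
  generalize Real.exp (-B / 2) = E' at h5 ⊢
  field_simp
  linear_combination (2 * Real.exp (-β) * eigenGap β B) * h5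

theorem APlus_pos : 0 < APlus β B := by
  have hl := lambdaPlus_pos β B
  refine pos_of_mul_pos_left ?_ (sq_nonneg (lambdaPlus β B))
  rw [APlus_mul_sq]
  have := eigenGap_pos β B
  have := eigenNormSq_pos β B
  positivity

-- If it vanished, the endpoint vector would be a leading eigenvector, so `eigenGap = e^{-B}
-- e^{-β}`. The quadratic equation then becomes `(1 - e^{-2B})(1 - e^{-2β}) = 0`, which forces `B =
-- 0` or `β = 0`.
variable {β} in
theorem AMinus_pos (hβ : 0 < β) (hB : B ≠ 0) : 0 < AMinus β B := by
  have hl := lambdaMinus_pos B hβ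
  refine pos_of_mul_pos_left ?_ (sq_nonneg (lambdaMinus β B))
  rw [AMinus_mul_sq B hβ]
  have hn := eigenNormSq_pos β B
  have hne : Real.exp (-B / 2) * Real.exp (-β) - Real.exp (B / 2) * eigenGap β B ≠ 0 := by
    intro h
    have hg : eigenGap β B = Real.exp (-B) * Real.exp (-β) := by
      refine mul_left_cancel₀ (Real.exp_pos (B / 2)).ne' ?_
      rw [← mul_assoc, ← Real.exp_add, show B / 2 + -B = -B / 2 by ring]
      linarith
    have hq := eigenGap_quadratic β B
    rw [hg] at hq
    have e1 : Real.exp (-B) * Real.exp B = 1 := by rw [← Real.exp_add]; simp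
    have e2 : Real.exp (-β) * Real.exp β = 1 := by rw [← Real.exp_add]; simp
    rw [Real.exp_add, sub_eq_add_neg β B, Real.exp_add] at hq
    have hq' : (1 - Real.exp (-B) ^ 2) * (1 - Real.exp (-β) ^ 2) = 0 := by
      linear_combination hq - Real.exp (-β) * Real.exp β * e1 + (Real.exp (-B) ^ 2 - 1) * e2
    rcases mul_eq_zero.1 hq' with h | h
    · have : Real.exp (-B) = 1 := by
        nlinarith [Real.exp_pos (-B)]
      rw [Real.exp_eq_one_iff] at this
      exact hB (by linarith)
    · have : Real.exp (-β) = 1 := by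
        nlinarith [Real.exp_pos (-β)]
      rw [Real.exp_eq_one_iff] at this
      linarith
  positivity

-- Without field the leading eigenvector is proportional to `(1, 1)`, the endpoint vector itself.
variable {β} in
theorem AMinus_zero (hβ : 0 < β) : AMinus β 0 = 0 := by
  have hl := lambdaMinus_pos 0 hβ
  have h := AMinus_mul_sq 0 hβ
  have hg : eigenGap β 0 = Real.exp (-β) := by
    have := eigenGap_quadratic β 0
    simp only [add_zero, sub_zero, sub_self, zero_mul] at this
    exact (pow_left_inj₀ (eigenGap_pos β 0).le (Real.exp_pos _).le two_ne_zero).1 this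
  rw [hg] at h
  simp only [neg_zero, zero_div, sub_self, ne_eq, OfNat.ofNat_ne_zero, not_false_eq_true, zero_pow,
    mul_zero] at h
  exact (mul_eq_zero.1 h).resolve_right (pow_ne_zero 2 hl.ne')

variable {β} in
/-- Real half-edge amplitudes diagonalizing the transfer matrix. -/
theorem exists_diagonal_amplitude (hβ : 0 < β) : ∃ x y : ℤˣ → ℝ,
    (∀ s t : ℤˣ, x s * x t + y s * y t = Real.exp (β * ((s : ℤ) * (t : ℤ)))) ∧
    ∑ s : ℤˣ, Real.exp (B * (s : ℤ)) * x s ^ 2 = lambdaPlus β B ∧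
    ∑ s : ℤˣ, Real.exp (B * (s : ℤ)) * y s ^ 2 = lambdaMinus β B ∧
    ∑ s : ℤˣ, Real.exp (B * (s : ℤ)) * (x s * y s) = 0 ∧
    (∑ s : ℤˣ, Real.exp (B * (s : ℤ)) * x s) ^ 2 = APlus β B * lambdaPlus β B ^ 2 ∧
    (∑ s : ℤˣ, Real.exp (B * (s : ℤ)) * y s) ^ 2 = AMinus β B * lambdaMinus β B ^ 2 := by
  have hp := lambdaPlus_pos β B
  have hm := lambdaMinus_pos B hβ
  have hD := eigenNormSq_pos β B
  have sp := Real.sq_sqrt hp.le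
  have sm := Real.sq_sqrt hm.le
  have sD := Real.sq_sqrt hD.le
  have sD0 : √(eigenNormSq β B) ≠ 0 := (Real.sqrt_pos.2 hD).ne'
  have hq := eigenGap_quadratic β B
  have lp := lambdaPlus_eq β B
  have lm := lambdaMinus_eq β B
  rw [APlus_mul_sq, AMinus_mul_sq B hβ]
  have h3 : Real.exp B = Real.exp (B / 2) ^ 2 := by
    rw [← Real.exp_nat_mul]; congr 1; push_cast; ring
  have h4 : Real.exp (-B) = Real.exp (-B / 2) ^ 2 := by
    rw [← Real.exp_nat_mul]; congr 1; push_cast; ring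
  have h5 : Real.exp (B / 2) * Real.exp (-B / 2) = 1 := by
    rw [← Real.exp_add, show B / 2 + -B / 2 = 0 by ring, Real.exp_zero]
  have hB : Real.exp (β + B) = Real.exp β * Real.exp (B / 2) ^ 2 := by rw [Real.exp_add, h3]
  have hB' : Real.exp (β - B) = Real.exp β * Real.exp (-B / 2) ^ 2 := by
    rw [sub_eq_add_neg, Real.exp_add, h4]
  rw [hB, hB'] at hq
  rw [hB] at lp
  rw [hB'] at lm
  have hDdef : eigenNormSq β B = Real.exp (-β) ^ 2 + eigenGap β B ^ 2 := rfl
  have hne : (-1 : ℤˣ) ≠ 1 := by decide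
  generalize eigenGap β B = g at *
  generalize hh : Real.exp (-β) = h at *
  generalize Real.exp (B / 2) = E at *
  generalize Real.exp (-B / 2) = E' at *
  generalize lambdaPlus β B = P at *
  generalize lambdaMinus β B = Q at *
  generalize eigenNormSq β B = D at *
  generalize hc : Real.exp β = c at *
  have key1 : E' ^ 2 * (P * h ^ 2 + Q * g ^ 2) = c * D := by
    linear_combination E' ^ 2 * (h ^ 2 * lp + g ^ 2 * lm) - E' ^ 2 * g * hq +
      c * (h ^ 2 + g ^ 2) * (E * E' + 1) * h5 - c * hDdef
  have key2 : E ^ 2 * (P * g ^ 2 + Q * h ^ 2) = c * D := by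
    linear_combination E ^ 2 * (g ^ 2 * lp + h ^ 2 * lm) + E ^ 2 * g * hq +
      c * (h ^ 2 + g ^ 2) * (E * E' + 1) * h5 - c * hDdef
  have key3 : (P - Q) * g = D := by
    linear_combination g * lp - g * lm + hq - hDdef
  -- The spectral decomposition of the transfer matrix has rank-one parts with vectors `√λ₊ (h, g) /
  -- √D` and `√λ₋ (-g, h) / √D`; dividing the entry at `s` by `e^{Bs/2}` removes the field and
  -- leaves the bare edge weight.
  refine ⟨fun s => if s = 1 then √P * E' * h / √D else √P * E * g / √D,
    fun s => if s = 1 then -(√Q * E' * g / √D) else √Q * E * h / √D, ?_, ?_, ?_, ?_, ?_, ?_⟩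
  · have cross : (√P * E' * h / √D) * (√P * E * g / √D) - (√Q * E' * g / √D) * (√Q * E * h / √D)
        = h := by
      field_simp
      linear_combination (E * E' * g * h) * (sp - sm) - h * sD + h * E * E' * key3 + h * D * h5
    intro s t
    rcases Int.units_eq_one_or s with rfl | rfl <;> rcases Int.units_eq_one_or t with rfl | rfl <;>
      simp only [if_true, if_neg hne] <;> push_cast <;>
      simp only [mul_neg, mul_one, neg_neg, hc, hh]
    · field_simp
      linear_combination E' ^ 2 * h ^ 2 * sp + E' ^ 2 * g ^ 2 * sm + key1 - c * sD
    · linear_combination cross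
    · linear_combination cross
    · field_simp
      linear_combination E ^ 2 * g ^ 2 * sp + E ^ 2 * h ^ 2 * sm + key2 - c * sD
  all_goals
    simp only [sum_units_int, if_true, if_neg hne]
    push_cast
    simp only [mul_one, mul_neg, h3, h4]
    field_simp
  · linear_combination (E ^ 2 * E' ^ 2 * (h ^ 2 + g ^ 2)) * sp +
      P * (h ^ 2 + g ^ 2) * (E * E' + 1) * h5 - P * hDdef - P * sD
  · linear_combination (E ^ 2 * E' ^ 2 * (h ^ 2 + g ^ 2)) * sm +
      Q * (h ^ 2 + g ^ 2) * (E * E' + 1) * h5 - Q * hDdef - Q * sD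
  · ring
  · rw [sp, sD]
    linear_combination P * D * (E * h + E' * g) ^ 2 * (E * E' + 1) * h5
  · rw [sm, sD]
    linear_combination Q * D * (E * g - E' * h) ^ 2 * (E * E' + 1) * h5

end Eigen

/-! ### Exact evaluation of the annealed partition function. -/

/-- The generating function of the line lengths, with `2m` vertices of degree one and `n`
vertices of degree two. -/
noncomputable def lineSum (x r : ℝ) (m n : ℕ) : ℝ :=
  ∑ s ∈ Finset.range (m + 1), ∑ k ∈ Finset.range (n + 1),
    (2 * m).choose (2 * s) * n.choose k * x ^ s * r ^ k * pairRatio (m - s + (n - k)) (s + k)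

theorem degree_counts {N : ℕ} {d : Fin N → ℕ} (hd : ∀ i, d i = 1 ∨ d i = 2) :
    (Finset.univ.filter fun i => d i = 1).card + (Finset.univ.filter fun i => d i = 2).card = N ∧
      ∑ i, d i = (Finset.univ.filter fun i => d i = 1).card +
        (Finset.univ.filter fun i => d i = 2).card * 2 := by
  constructor
  · have h := congrArg Multiplicative.toAdd
      (prod_eq_pow_mul_pow hd (R := Multiplicative ℕ) fun _ => Multiplicative.ofAdd 1)
    simpa using h.symm
  · have h := congrArg Multiplicative.toAdd
      (prod_eq_pow_mul_pow hd (R := Multiplicative ℕ) Multiplicative.ofAdd)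
    simpa using h

theorem graphMean_partitionFunction (β B : ℝ) {N : ℕ} (d : Fin N → ℕ) :
    graphMean (partitionFunction β B : Pairing d → ℝ) =
      ∑ σ : Spins N, Real.exp (B * totalSpin σ) *
        graphMean (fun π : Pairing d => Real.exp (β * edgeSum π σ)) := by
  unfold graphMean partitionFunction boltzmannWeight
  simp only [mul_div_assoc', Finset.mul_sum]
  rw [Finset.sum_comm, Finset.sum_div]
  refine Finset.sum_congr rfl fun σ _ => ?_
  congr 1
  refine Finset.sum_congr rfl fun π _ => ?_
  rw [← Real.exp_add, add_comm]

-- With amplitudes `x ± iy`, the vertex polynomials are `U(1 + X) - iW(1 - X)` and `λ₊(1 + X)² -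
-- λ₋(1 - X)²`; orthogonality of `x` and `y` removes the cross term. `coeff_central_diagonal` then
-- applies, and dividing by the leading factors leaves only the ratios.
open Polynomial in
theorem graphMean_partitionFunction_eq_lineSum {β : ℝ} (hβ : 0 < β) (B : ℝ) {N : ℕ}
    {d : Fin N → ℕ} (hd : ∀ i, d i = 1 ∨ d i = 2) (hev : Even (∑ i, d i)) :
    graphMean (partitionFunction β B : Pairing d → ℝ) /
        (lambdaPlus β B ^ N * APlus β B ^ ((Finset.univ.filter fun i => d i = 1).card / 2)) =
      lineSum (ratioA β B * ratioLambda β B ^ 2) (ratioLambda β B)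
        ((Finset.univ.filter fun i => d i = 1).card / 2)
        (Finset.univ.filter fun i => d i = 2).card := by
  obtain ⟨hN, hsum⟩ := degree_counts hd
  -- Even total degree makes the number of degree-one vertices even, so the division by `2` is
  -- exact.
  obtain ⟨m, hm⟩ : Even (Finset.univ.filter fun i => d i = 1).card := by
    rw [hsum] at hev
    exact (Nat.even_add.1 hev).2 (even_two.mul_left _)
  have hprod := fun F : ℕ → ℂ[X] => prod_eq_pow_mul_pow hd F
  set n₂ := (Finset.univ.filter fun i => d i = 2).card
  rw [hm, ← two_mul] at hN hsum hprod ⊢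
  rw [Nat.mul_div_cancel_left m two_pos]
  have hM : ∑ i, d i = 2 * (m + n₂) := by omega
  obtain ⟨x, y, hxy, hx, hy, hxy0, hU, hW⟩ := exists_diagonal_amplitude B hβ
  set U := ∑ s : ℤˣ, Real.exp (B * (s : ℤ)) * x s with hUdef
  set W := ∑ s : ℤˣ, Real.exp (B * (s : ℤ)) * y s with hWdef
  have hab : ∀ s t : ℤˣ, ((x s : ℂ) + Complex.I * y s) * ((x t : ℂ) - Complex.I * y t) +
      ((x s : ℂ) - Complex.I * y s) * ((x t : ℂ) + Complex.I * y t) =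
      2 * Complex.exp (β * ((s : ℤ) * (t : ℤ))) := by
    intro s t
    have h := congrArg (Complex.ofReal) (hxy s t)
    push_cast at h
    linear_combination 2 * h - 2 * (y s : ℂ) * y t * Complex.I_sq
  have hmain := choose_mul_annealedPartition hab hM (B : ℂ)
  rw [hprod] at hmain
  have hv1 : vertexPoly (fun s => (x s : ℂ) + Complex.I * y s) (fun s => (x s : ℂ) - Complex.I * y s)
      B 1 = C (U : ℂ) * (1 + X) - C (Complex.I * W) * (1 - X) := by
    simp only [vertexPoly, sum_units_int, hUdef, hWdef]
    push_cast
    simp only [C_add, C_sub, C_mul]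
    ring
  have hCI : (C Complex.I : ℂ[X]) ^ 2 = -1 := by rw [← C_pow, Complex.I_sq, C_neg, C_1]
  have hv2 : vertexPoly (fun s => (x s : ℂ) + Complex.I * y s) (fun s => (x s : ℂ) - Complex.I * y s)
      B 2 = C (lambdaPlus β B : ℂ) * (1 + X) ^ 2 - C (lambdaMinus β B : ℂ) * (1 - X) ^ 2 := by
    have h0 := congrArg (fun t : ℝ => C (t : ℂ)) hxy0
    simp only [sum_units_int] at h0
    rw [← hx, ← hy]
    simp only [vertexPoly, sum_units_int]
    push_cast at h0 ⊢
    simp only [C_add, C_sub, C_mul, C_pow, C_0] at h0 ⊢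
    linear_combination (2 * C Complex.I * (X ^ 2 - 1)) * h0 +
      ((1 - X) ^ 2 * (C (Complex.exp (B * 1)) * C (y 1 : ℂ) ^ 2 +
        C (Complex.exp (B * -1)) * C (y (-1) : ℂ) ^ 2)) * hCI
  rw [hv1, hv2, coeff_central_diagonal] at hmain
  have hch : ((2 * (m + n₂)).choose (m + n₂) : ℝ) ≠ 0 := by
    exact_mod_cast (Nat.choose_pos (by omega)).ne'
  have hreal : graphMean (partitionFunction β B : Pairing d → ℝ) =
      ∑ s ∈ Finset.range (m + 1), ∑ k ∈ Finset.range (n₂ + 1),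
          (2 * m).choose (2 * s) * n₂.choose k * ((U ^ 2) ^ (m - s) * (W ^ 2) ^ s) *
            (lambdaPlus β B ^ (n₂ - k) * lambdaMinus β B ^ k) *
              pairRatio (m - s + (n₂ - k)) (s + k) := by
    refine mul_left_cancel₀ hch ?_
    rw [graphMean_partitionFunction]
    rw [← Complex.ofReal_inj, ← hmain]
    push_cast
    rfl
  rw [hreal, lineSum, Finset.sum_div]
  refine Finset.sum_congr rfl fun s hs => ?_
  rw [Finset.sum_div]
  refine Finset.sum_congr rfl fun k hk => ?_
  have hs' : s ≤ m := by simpa [Nat.lt_succ_iff] using hs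
  have hk' : k ≤ n₂ := by simpa [Nat.lt_succ_iff] using hk
  have hl := (lambdaPlus_pos β B).ne'
  have hA := (APlus_pos β B).ne'
  rw [hU, hW, ratioA, ratioLambda, ← hN]
  obtain ⟨i, rfl⟩ := Nat.exists_eq_add_of_le hs'
  obtain ⟨j, hj⟩ := Nat.exists_eq_add_of_le hk'
  rw [hj]
  simp only [Nat.add_sub_cancel_left]
  generalize lambdaPlus β B = P at *
  generalize lambdaMinus β B = Q at *
  generalize APlus β B = A at *
  generalize AMinus β B = A' at *
  simp only [mul_pow, div_pow, pow_add, ← pow_mul]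
  field_simp
  ring

/-! ### Stirling's formula with uniform error. -/

section Stirling

theorem log_factorial_error (n : ℕ) :
    |Real.log n.factorial - ((n : ℝ) * Real.log n - n)| ≤ 1 + Real.log (n + 1) := by
  rcases n.eq_zero_or_pos with rfl | hn
  · simp
  have hn1 : (1 : ℝ) ≤ n := by exact_mod_cast hn
  have hln : 0 ≤ Real.log n := Real.log_nonneg hn1
  have hle : Real.log n ≤ Real.log (n + 1) := Real.log_le_log (by linarith) (by linarith)
  have h1 := Stirling.le_log_factorial_stirling hn.ne'
  have h2pi : 0 ≤ Real.log (2 * Real.pi) := Real.log_nonneg (by linarith [Real.pi_gt_three])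
  have h2 := Stirling.log_stirlingSeq_formula n
  have h3 : Real.log (Stirling.stirlingSeq n) ≤ Real.log (Stirling.stirlingSeq 1) := by
    obtain ⟨k, rfl⟩ := Nat.exists_eq_succ_of_ne_zero hn.ne'
    exact Stirling.log_stirlingSeq'_antitone (Nat.zero_le k)
  rw [h2, Stirling.stirlingSeq_one, Real.log_div (Real.exp_pos 1).ne' (by positivity), Real.log_exp,
    Real.log_sqrt (by norm_num), Real.log_mul (by norm_num) (by positivity),
    Real.log_div (by positivity) (Real.exp_pos 1).ne', Real.log_exp] at h3
  rw [abs_le]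
  constructor <;> linarith

/-- `x log x`, with value `0` at `0`. -/
noncomputable def xlogx (x : ℝ) : ℝ := x * Real.log x

theorem continuous_xlogx : Continuous xlogx := Real.continuous_mul_log

theorem xlogx_mul (x y : ℝ) : xlogx (x * y) = y * xlogx x + x * xlogx y := by
  have := Real.negMulLog_mul x y
  simp only [Real.negMulLog_def] at this
  simp only [xlogx]
  linarith

/-- The terms linear in `n` cancel in the factorial quotients used below, leaving `N` times a sum of
`xlogx` at densities. -/
theorem log_factorial_scaled (n : ℕ) {N : ℝ} (hN : 0 < N) :
    |Real.log n.factorial - (N * xlogx (n / N) + n * Real.log N - n)| ≤ 1 + Real.log (n + 1) := by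
  have h := xlogx_mul (n / N) N
  rw [div_mul_cancel₀ _ hN.ne'] at h
  have h2 : (n : ℝ) / N * xlogx N = n * Real.log N := by
    rw [xlogx]; field_simp
  rw [h2] at h
  rw [← h, xlogx]
  exact log_factorial_error n

end Stirling

/-! ### Exponential rate of the single terms. -/

section Rate

/-- The exponential rate of the terms of `lineSum`. -/
noncomputable def termRate (x r p s t : ℝ) : ℝ :=
  xlogx (1 - p) - xlogx (2 * s) - xlogx (1 - p - 2 * s) + xlogx p - xlogx t - xlogx (p - t)
    + s * Real.log x + t * Real.log r
    + xlogx (1 + p - 2 * s - 2 * t) + xlogx (2 * s + 2 * t) + xlogx ((1 + p) / 2)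
    - xlogx ((1 + p) / 2 - s - t) - xlogx (s + t) - xlogx (1 + p)

theorem xlogx_two_mul (x : ℝ) : xlogx (2 * x) = 2 * xlogx x + 2 * x * Real.log 2 := by
  rw [xlogx_mul, xlogx, xlogx]; ring

/-- Halving the arguments of `xlogx` produces multiples of `log 2` that add up to zero. -/
theorem termRate_eq_H (p β B s t : ℝ) :
    termRate (ratioA β B * ratioLambda β B ^ 2) (ratioLambda β B) p s t = H p β B s t := by
  have e1 : 1 - p = 2 * ((1 - p) / 2) := by ring
  have e2 : 1 - p - 2 * s = 2 * ((1 - p) / 2 - s) := by ring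
  have e3 : 1 + p - 2 * s - 2 * t = 2 * ((1 + p) / 2 - s - t) := by ring
  have e4 : 2 * s + 2 * t = 2 * (s + t) := by ring
  have e5 : 1 + p = 2 * ((1 + p) / 2) := by ring
  have f1 : xlogx (1 - p) = 2 * xlogx ((1 - p) / 2) + (1 - p) * Real.log 2 := by
    conv_lhs => rw [e1]
    rw [xlogx_two_mul]; ring
  have f5 : xlogx (1 + p) = 2 * xlogx ((1 + p) / 2) + (1 + p) * Real.log 2 := by
    conv_lhs => rw [e5]
    rw [xlogx_two_mul]; ring
  rw [termRate, e2, e3, e4, f1, f5]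
  simp only [xlogx_two_mul]
  unfold xlogx H
  ring

theorem continuous_termRate (x r : ℝ) :
    Continuous fun q : ℝ × ℝ × ℝ => termRate x r q.1 q.2.1 q.2.2 := by
  have := continuous_xlogx
  unfold termRate
  fun_prop

theorem log_lineSum_term {x r : ℝ} (hx : 0 < x) (hr : 0 < r) {m n s k : ℕ} (hs : s ≤ m)
    (hk : k ≤ n) (hN : 0 < 2 * m + n) :
    0 < (2 * m).choose (2 * s) * n.choose k * x ^ s * r ^ k * pairRatio (m - s + (n - k)) (s + k) ∧
    |Real.log ((2 * m).choose (2 * s) * n.choose k * x ^ s * r ^ k *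
        pairRatio (m - s + (n - k)) (s + k)) -
      (2 * m + n : ℕ) * termRate x r (n / (2 * m + n : ℕ)) (s / (2 * m + n : ℕ))
        (k / (2 * m + n : ℕ))| ≤ 14 * (1 + Real.log (2 * (2 * m + n : ℕ) + 1)) := by
  have hc1 : 0 < (2 * m).choose (2 * s) := Nat.choose_pos (by omega)
  have hc2 : 0 < n.choose k := Nat.choose_pos hk
  have hpr := pairRatio_pos (m - s + (n - k)) (s + k)
  refine ⟨by positivity, ?_⟩
  set N : ℝ := ((2 * m + n : ℕ) : ℝ) with hNdef
  have hN0 : 0 < N := by rw [hNdef]; exact_mod_cast hN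
  have hNval : N = 2 * m + n := by rw [hNdef]; push_cast; ring
  have hf : ∀ j : ℕ, (j.factorial : ℝ) ≠ 0 := fun j => by positivity
  have hch : ∀ a b : ℕ, b ≤ a → Real.log (a.choose b) =
      Real.log a.factorial - Real.log b.factorial - Real.log (a - b).factorial := by
    intro a b hab
    rw [Nat.cast_choose ℝ hab, Real.log_div (hf _) (mul_ne_zero (hf _) (hf _)),
      Real.log_mul (hf _) (hf _)]
    ring
  have hjq : m - s + (n - k) + (s + k) = m + n := by omega
  rw [Real.log_mul (by positivity) hpr.ne', Real.log_mul (by positivity) (by positivity),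
    Real.log_mul (by positivity) (by positivity), Real.log_mul (by positivity) (by positivity),
    Real.log_pow, Real.log_pow, hch _ _ (by omega), hch _ _ hk, pairRatio,
    Real.log_div (by positivity) (by positivity), Real.log_mul (by positivity) (hf _),
    Real.log_mul (hf _) (hf _), Real.log_mul (by positivity) (hf _), Real.log_mul (hf _) (hf _), hjq]
  -- The factorials of `pairRatio` reach `2(m + n)`, hence the range up to `2N`. Twelve factorials
  -- occur, so the factor `14` leaves room.
  have herr : ∀ j : ℕ, j ≤ 2 * (2 * m + n) →
      |Real.log j.factorial - (N * xlogx (j / N) + j * Real.log N - j)| ≤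
        1 + Real.log (2 * N + 1) := by
    intro j hj
    refine (log_factorial_scaled j hN0).trans ?_
    have : (j : ℝ) ≤ 2 * N := by rw [hNdef]; exact_mod_cast hj
    gcongr
  have a1 := abs_le.1 (herr (2 * m) (by omega))
  have a2 := abs_le.1 (herr (2 * s) (by omega))
  have a3 := abs_le.1 (herr (2 * m - 2 * s) (by omega))
  have a4 := abs_le.1 (herr n (by omega))
  have a5 := abs_le.1 (herr k (by omega))
  have a6 := abs_le.1 (herr (n - k) (by omega))
  have a7 := abs_le.1 (herr (2 * (m - s + (n - k))) (by omega))
  have a8 := abs_le.1 (herr (2 * (s + k)) (by omega))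
  have a9 := abs_le.1 (herr (m + n) (by omega))
  have a10 := abs_le.1 (herr (m - s + (n - k)) (by omega))
  have a11 := abs_le.1 (herr (s + k) (by omega))
  have a12 := abs_le.1 (herr (2 * (m + n)) (by omega))
  have c3 : ((2 * m - 2 * s : ℕ) : ℝ) = 2 * m - 2 * s := by
    rw [Nat.cast_sub (by omega)]; push_cast; ring
  have c6 : ((n - k : ℕ) : ℝ) = n - k := Nat.cast_sub hk
  have c10 : ((m - s + (n - k) : ℕ) : ℝ) = m - s + (n - k) := by
    rw [Nat.cast_add, Nat.cast_sub hs, Nat.cast_sub hk]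
  have c7 : ((2 * (m - s + (n - k)) : ℕ) : ℝ) = 2 * (m - s + (n - k)) := by
    rw [Nat.cast_mul, c10]; norm_num
  have hlog : 0 ≤ Real.log (2 * N + 1) := Real.log_nonneg (by linarith)
  have b1 : ((2 * m : ℕ) : ℝ) / N = 1 - n / N := by
    field_simp; rw [hNval]; push_cast; ring
  have b2 : ((2 * s : ℕ) : ℝ) / N = 2 * (s / N) := by push_cast; ring
  have b3 : ((2 * m - 2 * s : ℕ) : ℝ) / N = 1 - n / N - 2 * (s / N) := by
    rw [c3]; field_simp; rw [hNval]; ring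
  have b6 : ((n - k : ℕ) : ℝ) / N = n / N - k / N := by rw [c6]; ring
  have b7 : ((2 * (m - s + (n - k)) : ℕ) : ℝ) / N = 1 + n / N - 2 * (s / N) - 2 * (k / N) := by
    rw [c7]; field_simp; rw [hNval]; ring
  have b8 : ((2 * (s + k) : ℕ) : ℝ) / N = 2 * (s / N) + 2 * (k / N) := by push_cast; ring
  have b9 : ((m + n : ℕ) : ℝ) / N = (1 + n / N) / 2 := by
    field_simp; rw [hNval]; push_cast; ring
  have b10 : ((m - s + (n - k) : ℕ) : ℝ) / N = (1 + n / N) / 2 - s / N - k / N := by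
    rw [c10]; field_simp; rw [hNval]; ring
  have b11 : ((s + k : ℕ) : ℝ) / N = s / N + k / N := by push_cast; ring
  have b12 : ((2 * (m + n) : ℕ) : ℝ) / N = 1 + n / N := by
    field_simp; rw [hNval]; push_cast; ring
  have d1 : N * (s / N * Real.log x) = s * Real.log x := by field_simp
  have d2 : N * (k / N * Real.log r) = k * Real.log r := by field_simp
  rw [b1] at a1
  rw [b2] at a2
  rw [b3, c3] at a3
  rw [b6, c6] at a6
  rw [b7, c7] at a7
  rw [b8] at a8
  rw [b9] at a9
  rw [b10, c10] at a10
  rw [b11] at a11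
  rw [b12] at a12
  push_cast at a1 a2 a8 a9 a11 a12
  rw [termRate]
  simp only [mul_add, mul_sub, d1, d2, add_mul, sub_mul] at *
  rw [abs_le]
  constructor <;> linarith

end Rate

/-! ### Laplace's method for the double sum. -/

/-- `termRate` on the unit square, after rescaling its domain. -/
noncomputable def scaledRate (x r p : ℝ) (q : ℝ × ℝ) : ℝ :=
  termRate x r p ((1 - p) / 2 * q.1) (p * q.2)

theorem continuous_scaledRate (x r : ℝ) : Continuous ↿(scaledRate x r) :=
  (continuous_termRate x r).comp (f := fun q : ℝ × ℝ × ℝ =>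
    (q.1, (1 - q.1) / 2 * q.2.1, q.1 * q.2.2)) (by fun_prop)

theorem isCompact_unitSquare : IsCompact (Set.Icc (0 : ℝ) 1 ×ˢ Set.Icc (0 : ℝ) 1) :=
  isCompact_Icc.prod isCompact_Icc

/-- The maximum of `termRate` over its domain. -/
noncomputable def maxRate (x r p : ℝ) : ℝ :=
  sSup (scaledRate x r p '' (Set.Icc (0 : ℝ) 1 ×ˢ Set.Icc (0 : ℝ) 1))

/-- Rescaling to a fixed compact square makes the maximum continuous in `p`. This is needed because
at finite size the density `n / N` only approximates `p`. -/
theorem continuous_maxRate (x r : ℝ) : Continuous (maxRate x r) :=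
  isCompact_unitSquare.continuous_sSup (continuous_scaledRate x r)

theorem maxRate_eq {p : ℝ} (hp0 : 0 < p) (hp1 : p < 1) (x r : ℝ) :
    maxRate x r p =
      sSup ((fun q : ℝ × ℝ => termRate x r p q.1 q.2) ''
        (Set.Icc 0 ((1 - p) / 2) ×ˢ Set.Icc 0 p)) := by
  have hq : 0 < (1 - p) / 2 := by linarith
  unfold maxRate
  congr 1
  ext y
  simp only [Set.mem_image, Set.mem_prod, Set.mem_Icc, Prod.exists, scaledRate]
  constructor
  · rintro ⟨u, v, ⟨⟨hu0, hu1⟩, hv0, hv1⟩, rfl⟩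
    exact ⟨(1 - p) / 2 * u, p * v, ⟨⟨by positivity, by nlinarith⟩, by positivity, by nlinarith⟩, rfl⟩
  · rintro ⟨s, t, ⟨⟨hs0, hs1⟩, ht0, ht1⟩, rfl⟩
    refine ⟨s / ((1 - p) / 2), t / p, ⟨⟨by positivity, ?_⟩, by positivity, ?_⟩, ?_⟩
    · rwa [div_le_one hq]
    · rwa [div_le_one hp0]
    · rw [mul_div_cancel₀ _ hq.ne', mul_div_cancel₀ _ hp0.ne']

theorem termRate_le_maxRate (x r : ℝ) {m n s k : ℕ} (hs : s ≤ m) (hk : k ≤ n)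
    (hN : 0 < 2 * m + n) :
    termRate x r (n / (2 * m + n : ℕ)) (s / (2 * m + n : ℕ)) (k / (2 * m + n : ℕ)) ≤
      maxRate x r (n / (2 * m + n : ℕ)) := by
  set N : ℝ := ((2 * m + n : ℕ) : ℝ) with hNdef
  have hN0 : 0 < N := by rw [hNdef]; exact_mod_cast hN
  have hNval : N = 2 * m + n := by rw [hNdef]; push_cast; ring
  have hratio : ∀ a b : ℕ, a ≤ b → (a : ℝ) / b ∈ Set.Icc (0 : ℝ) 1 := fun a b hab =>
    ⟨by positivity, div_le_one_of_le₀ (by exact_mod_cast hab) (by positivity)⟩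
  -- For `b = 0` the default value of `a / b` is harmless, since then `a = 0`.
  have hcancel : ∀ a b : ℕ, a ≤ b → (b : ℝ) * (a / b) = a := by
    intro a b hab
    rcases b.eq_zero_or_pos with rfl | hb
    · simp [Nat.le_zero.1 hab]
    · field_simp
  refine le_csSup ((isCompact_unitSquare.image
    ((continuous_scaledRate x r).comp (Continuous.prodMk_right _))).bddAbove) ?_
  refine ⟨((s : ℝ) / m, (k : ℝ) / n), ⟨hratio _ _ hs, hratio _ _ hk⟩, ?_⟩
  simp only [scaledRate]
  congr 1
  · rw [show (1 - (n : ℝ) / N) / 2 = m / N by field_simp; rw [hNval]; ring, div_mul_eq_mul_div,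
      hcancel _ _ hs]
  · rw [div_mul_eq_mul_div, hcancel _ _ hk]

theorem tendsto_log_div_atTop (a b c : ℝ) (ha : 0 < a) :
    Tendsto (fun N : ℕ => c * (b + Real.log (a * N + 1)) / N) atTop (𝓝 0) := by
  have h1 : Tendsto (fun N : ℕ => a * (N : ℝ) + 1) atTop atTop :=
    tendsto_atTop_add_const_right _ _ (tendsto_natCast_atTop_atTop.const_mul_atTop ha)
  have h2 := (Real.isLittleO_log_id_atTop.tendsto_div_nhds_zero).comp h1
  have h4 : Tendsto (fun N : ℕ => (1 : ℝ) / N) atTop (𝓝 0) := tendsto_one_div_atTop_nhds_zero_nat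
  have h5 : Tendsto (fun N : ℕ => c * (b * (1 / N) +
      Real.log (a * N + 1) / (a * N + 1) * (a + 1 / N))) atTop (𝓝 (c * (b * 0 + 0 * (a + 0)))) :=
    ((h4.const_mul b).add (h2.mul (h4.const_add a))).const_mul c
  simp only [mul_zero, zero_mul, add_zero] at h5
  refine h5.congr' ?_
  filter_upwards [eventually_gt_atTop 0] with N hN
  have hN' : (0 : ℝ) < N := by exact_mod_cast hN
  have : a * (N : ℝ) + 1 ≠ 0 := by positivity
  field_simp

section Laplace

variable {ι : Type*} {l : Filter ι} {m n : ι → ℕ}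

theorem tendsto_floor_mul_div {a : ι → ℕ} {N : ι → ℕ} (hN : Tendsto N l atTop) {c u : ℝ}
    (ha : Tendsto (fun i => (a i : ℝ) / N i) l (𝓝 c)) (hu : 0 ≤ u) :
    Tendsto (fun i => (⌊u * a i⌋₊ : ℝ) / N i) l (𝓝 (c * u)) := by
  have hinv : Tendsto (fun i => (1 : ℝ) / N i) l (𝓝 0) := tendsto_one_div_atTop_nhds_zero_nat.comp hN
  have h1 := ha.mul_const u
  have h2 : Tendsto (fun i => (a i : ℝ) / N i * u - 1 / N i) l (𝓝 (c * u)) := by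
    simpa using h1.sub hinv
  refine tendsto_of_tendsto_of_tendsto_of_le_of_le' h2 h1 ?_ ?_
  all_goals
    filter_upwards [hN.eventually_gt_atTop 0] with i hi
    have hi' : (0 : ℝ) < N i := by exact_mod_cast hi
    rw [div_mul_eq_mul_div]
  · rw [← sub_div]
    gcongr
    have := Nat.sub_one_lt_floor (u * a i)
    linarith
  · gcongr
    have := Nat.floor_le (show 0 ≤ u * (a i : ℝ) by positivity)
    linarith

theorem tendsto_termRate {x r p s t : ℝ} {f g h : ι → ℝ} (hf : Tendsto f l (𝓝 p))
    (hg : Tendsto g l (𝓝 s)) (hh : Tendsto h l (𝓝 t)) :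
    Tendsto (fun i => termRate x r (f i) (g i) (h i)) l (𝓝 (termRate x r p s t)) := by
  have key : ∀ F : ℝ × ℝ × ℝ → ℝ, Continuous F →
      Tendsto (fun i => F (f i, g i, h i)) l (𝓝 (F (p, s, t))) := fun F hF =>
    (hF.tendsto _).comp (hf.prodMk_nhds (hg.prodMk_nhds hh))
  simpa only using key _ (continuous_termRate x r)

theorem lineSum_pos {x r : ℝ} (hx : 0 < x) (hr : 0 < r) {m n : ℕ} (hN : 0 < 2 * m + n) :
    0 < lineSum x r m n :=
  Finset.sum_pos (fun s hs => Finset.sum_pos (fun k hk => (log_lineSum_term hx hr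
    (Nat.lt_succ_iff.1 (Finset.mem_range.1 hs)) (Nat.lt_succ_iff.1 (Finset.mem_range.1 hk)) hN).1)
    ⟨0, by simp⟩) ⟨0, by simp⟩

theorem le_log_lineSum {x r : ℝ} (hx : 0 < x) (hr : 0 < r) {m n s k : ℕ} (hs : s ≤ m)
    (hk : k ≤ n) (hN : 0 < 2 * m + n) :
    (2 * m + n : ℕ) * termRate x r (n / (2 * m + n : ℕ)) (s / (2 * m + n : ℕ))
        (k / (2 * m + n : ℕ)) - 14 * (1 + Real.log (2 * (2 * m + n : ℕ) + 1)) ≤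
      Real.log (lineSum x r m n) := by
  obtain ⟨hpos, hterm⟩ := log_lineSum_term hx hr hs hk hN
  have hk1 := Finset.single_le_sum (s := Finset.range (n + 1))
    (f := fun k => ((2 * m).choose (2 * s) : ℝ) * n.choose k *
      x ^ s * r ^ k * pairRatio (m - s + (n - k)) (s + k))
    (fun k hk => (log_lineSum_term hx hr hs (Nat.lt_succ_iff.1 (Finset.mem_range.1 hk)) hN).1.le)
    (Finset.mem_range.2 (Nat.lt_succ_iff.2 hk))
  have hs1 := Finset.single_le_sum (s := Finset.range (m + 1))
    (f := fun s => ∑ k ∈ Finset.range (n + 1), ((2 * m).choose (2 * s) : ℝ) * n.choose k *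
      x ^ s * r ^ k * pairRatio (m - s + (n - k)) (s + k))
    (fun s hs => Finset.sum_nonneg fun k hk => (log_lineSum_term hx hr
      (Nat.lt_succ_iff.1 (Finset.mem_range.1 hs)) (Nat.lt_succ_iff.1 (Finset.mem_range.1 hk)) hN).1.le)
    (Finset.mem_range.2 (Nat.lt_succ_iff.2 hs))
  have h1 := Real.log_le_log hpos (hk1.trans hs1)
  have h2 := (abs_le.1 hterm).1
  rw [lineSum]
  linarith

theorem log_lineSum_le {x r : ℝ} (hx : 0 < x) (hr : 0 < r) {m n : ℕ} (hN : 0 < 2 * m + n) :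
    Real.log (lineSum x r m n) ≤ (2 * m + n : ℕ) * maxRate x r (n / (2 * m + n : ℕ)) +
      14 * (1 + Real.log (2 * (2 * m + n : ℕ) + 1)) + 2 * Real.log ((2 * m + n : ℕ) + 1) := by
  set R := (2 * m + n : ℕ) * maxRate x r (n / (2 * m + n : ℕ)) +
      14 * (1 + Real.log (2 * (2 * m + n : ℕ) + 1)) with hR
  have hterm : ∀ s ∈ Finset.range (m + 1), ∀ k ∈ Finset.range (n + 1),
      ((2 * m).choose (2 * s) : ℝ) * n.choose k * x ^ s * r ^ k *
        pairRatio (m - s + (n - k)) (s + k) ≤ Real.exp R := by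
    intro s hs k hk
    have hs' := Nat.lt_succ_iff.1 (Finset.mem_range.1 hs)
    have hk' := Nat.lt_succ_iff.1 (Finset.mem_range.1 hk)
    obtain ⟨hpos, hterm⟩ := log_lineSum_term hx hr hs' hk' hN
    rw [← Real.log_le_iff_le_exp hpos]
    have h2 := (abs_le.1 hterm).2
    have h3 := mul_le_mul_of_nonneg_left (termRate_le_maxRate x r hs' hk' hN)
      (Nat.cast_nonneg (α := ℝ) (2 * m + n))
    linarith
  have h1 : lineSum x r m n ≤ (m + 1) * ((n + 1) * Real.exp R) := by
    refine (Finset.sum_le_card_nsmul _ _ _ fun s hs =>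
      Finset.sum_le_card_nsmul _ _ _ (hterm s hs)).trans (le_of_eq ?_)
    simp [nsmul_eq_mul]
  have h2 : lineSum x r m n ≤ (((2 * m + n : ℕ) : ℝ) + 1) ^ 2 * Real.exp R := by
    refine h1.trans ?_
    rw [← mul_assoc, pow_two]
    have hm1 : (m : ℝ) ≤ (2 * m + n : ℕ) := by exact_mod_cast (show m ≤ 2 * m + n by omega)
    have hn1 : (n : ℝ) ≤ (2 * m + n : ℕ) := by exact_mod_cast (show n ≤ 2 * m + n by omega)
    gcongr
  have h3 := Real.log_le_log (lineSum_pos hx hr hN) h2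
  rw [Real.log_mul (by positivity) (Real.exp_pos _).ne', Real.log_exp, Real.log_pow] at h3
  push_cast at h3 ⊢
  linarith

/-- There are at most `(N + 1)²` terms, so the largest one fixes the rate. The upper bound is
termwise; the lower bound uses the single term at the integer parts of a maximizer, rescaled. -/
theorem tendsto_log_lineSum {x r p : ℝ} (hx : 0 < x) (hr : 0 < r)
    (hN : Tendsto (fun i => 2 * m i + n i) l atTop)
    (hp : Tendsto (fun i => (n i : ℝ) / (2 * m i + n i : ℕ)) l (𝓝 p)) :
    Tendsto (fun i => 1 / ((2 * m i + n i : ℕ) : ℝ) * Real.log (lineSum x r (m i) (n i))) l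
      (𝓝 (maxRate x r p)) := by
  obtain ⟨N, hNi⟩ : ∃ N : ι → ℕ, ∀ i, 2 * m i + n i = N i := ⟨_, fun _ => rfl⟩
  simp only [hNi] at hN hp ⊢
  have hE := (tendsto_log_div_atTop 2 1 14 two_pos).comp hN
  have hE2 := (tendsto_log_div_atTop 1 0 2 one_pos).comp hN
  have hmp : Tendsto (fun i => (m i : ℝ) / N i) l (𝓝 ((1 - p) / 2)) := by
    refine ((hp.const_sub 1).div_const 2).congr' ?_
    filter_upwards [hN.eventually_gt_atTop 0] with i hi
    have hi' : (0 : ℝ) < N i := by exact_mod_cast hi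
    have : (N i : ℝ) = 2 * m i + n i := by rw [← hNi]; push_cast; ring
    field_simp
    rw [this]
    ring
  obtain ⟨⟨u, v⟩, ⟨⟨hu0, hu1⟩, hv0, hv1⟩, hmax⟩ := (isCompact_unitSquare.image
    ((continuous_scaledRate x r).comp (Continuous.prodMk_right p))).sSup_mem
      ⟨_, Set.mem_image_of_mem _ (show ((0 : ℝ), (0 : ℝ)) ∈ _ by simp)⟩
  have hmax' : termRate x r p ((1 - p) / 2 * u) (p * v) = maxRate x r p := hmax
  have hlow : Tendsto (fun i => termRate x r (n i / N i) ((⌊u * m i⌋₊ : ℝ) / N i)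
      ((⌊v * n i⌋₊ : ℝ) / N i) - 14 * (1 + Real.log (2 * N i + 1)) / N i) l
      (𝓝 (maxRate x r p)) := by
    rw [← hmax', ← sub_zero (termRate _ _ _ _ _)]
    refine Tendsto.sub ?_ hE
    exact tendsto_termRate hp (tendsto_floor_mul_div hN hmp hu0) (tendsto_floor_mul_div hN hp hv0)
  have hup : Tendsto (fun i => maxRate x r (n i / N i) + 14 * (1 + Real.log (2 * N i + 1)) / N i +
      2 * (0 + Real.log (1 * N i + 1)) / N i) l (𝓝 (maxRate x r p)) := by
    have := ((((continuous_maxRate x r).tendsto _).comp hp).add hE).add hE2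
    simpa using this
  refine tendsto_of_tendsto_of_tendsto_of_le_of_le' hlow hup ?_ ?_
  all_goals
    filter_upwards [hN.eventually_gt_atTop 0] with i hi
    have hi' : (0 : ℝ) < N i := by exact_mod_cast hi
  · have hs : ⌊u * m i⌋₊ ≤ m i := Nat.floor_le_of_le (by nlinarith [(m i).cast_nonneg (α := ℝ)])
    have hk : ⌊v * n i⌋₊ ≤ n i := Nat.floor_le_of_le (by nlinarith [(n i).cast_nonneg (α := ℝ)])
    have h1 := le_log_lineSum hx hr hs hk (by rw [hNi]; exact hi)
    rw [hNi] at h1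
    rw [one_div, ← div_eq_inv_mul, le_div_iff₀ hi', sub_mul, div_mul_cancel₀ _ hi'.ne', mul_comm]
    exact h1
  · have h1 := log_lineSum_le hx hr (m := m i) (n := n i) (by rw [hNi]; exact hi)
    rw [hNi] at h1
    rw [one_div, ← div_eq_inv_mul, div_le_iff₀ hi', add_mul, add_mul, div_mul_cancel₀ _ hi'.ne',
      div_mul_cancel₀ _ hi'.ne', zero_add, one_mul, mul_comm (maxRate _ _ _)]
    exact h1

/-- Here `pairRatio j k = C(j+k, k) / C(2(j+k), 2k)`, and one summand of Vandermonde's identity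
gives `C(j+k, k)² ≤ C(2(j+k), 2k)`. -/
theorem choose_mul_pairRatio_le_one {n k j : ℕ} (hn : n ≤ j + k) :
    (n.choose k : ℝ) * pairRatio j k ≤ 1 := by
  have h1 := Nat.choose_mul_factorial_mul_factorial (show k ≤ j + k by omega)
  have h2 := Nat.choose_mul_factorial_mul_factorial (show 2 * k ≤ 2 * (j + k) by omega)
  rw [show j + k - k = j by omega] at h1
  rw [show 2 * (j + k) - 2 * k = 2 * j by omega] at h2
  have h3 : (j + k).choose k * (j + k).choose k ≤ (2 * (j + k)).choose (2 * k) := by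
    rw [two_mul (j + k), Nat.add_choose_eq (j + k) (j + k) (2 * k)]
    exact Finset.single_le_sum (s := Finset.HasAntidiagonal.antidiagonal (2 * k))
      (f := fun q : ℕ × ℕ => (j + k).choose q.1 * (j + k).choose q.2)
      (fun _ _ => Nat.zero_le _) (a := (k, k)) (Finset.HasAntidiagonal.mem_antidiagonal.2 (two_mul k).symm)
  have h4 : n.choose k ≤ (j + k).choose k := Nat.choose_le_choose k hn
  have h5 : pairRatio j k = (j + k).choose k / (2 * (j + k)).choose (2 * k) := by
    have hc : ((2 * (j + k)).choose (2 * k) : ℝ) ≠ 0 := by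
      exact_mod_cast (Nat.choose_pos (by omega)).ne'
    rw [pairRatio, ← h2]
    nth_rewrite 1 [← h1]
    push_cast
    field_simp
  rw [h5, mul_div_assoc']
  refine div_le_one_of_le₀ ?_ (by positivity)
  exact_mod_cast (Nat.mul_le_mul_right _ h4).trans h3

/-- Only `s = 0` survives, as `0 ^ 0 = 1`. The term `k = 0` equals `1` and every term is at most
`1`, so the sum lies between `1` and `n + 1`. -/
theorem tendsto_log_lineSum_zero {r : ℝ} (hr : 0 < r) (hr1 : r ≤ 1)
    (hN : Tendsto (fun i => 2 * m i + n i) l atTop) :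
    Tendsto (fun i => 1 / ((2 * m i + n i : ℕ) : ℝ) * Real.log (lineSum 0 r (m i) (n i))) l
      (𝓝 0) := by
  have hE2 := (tendsto_log_div_atTop 1 0 1 one_pos).comp hN
  have hsum : ∀ i, lineSum 0 r (m i) (n i) = ∑ k ∈ Finset.range (n i + 1),
      r ^ k * ((n i).choose k * pairRatio (m i + (n i - k)) k) := by
    intro i
    rw [lineSum, Finset.sum_range_succ', Finset.sum_eq_zero, zero_add]
    · refine Finset.sum_congr rfl fun k _ => ?_
      simp
      ring
    · intro s _
      exact Finset.sum_eq_zero fun k _ => by simp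
  have hlow : ∀ i, 1 ≤ lineSum 0 r (m i) (n i) := by
    intro i
    rw [hsum]
    have h := Finset.single_le_sum (s := Finset.range (n i + 1))
      (f := fun k => r ^ k * (((n i).choose k : ℝ) * pairRatio (m i + (n i - k)) k))
      (fun k _ => mul_nonneg (pow_nonneg hr.le k) (mul_nonneg (Nat.cast_nonneg _) (pairRatio_pos _ _).le))
      (Finset.mem_range.2 (Nat.succ_pos _))
    refine le_trans (le_of_eq ?_) h
    have : ((2 * (m i + n i)).factorial : ℝ) ≠ 0 := by positivity
    have : ((m i + n i).factorial : ℝ) ≠ 0 := by positivity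
    simp [pairRatio]
    field_simp
  refine tendsto_of_tendsto_of_tendsto_of_le_of_le' tendsto_const_nhds hE2 ?_ ?_
  · exact Eventually.of_forall fun i => mul_nonneg (by positivity) (Real.log_nonneg (hlow i))
  · filter_upwards [hN.eventually_gt_atTop 0] with i hi
    have hi' : (0 : ℝ) < (2 * m i + n i : ℕ) := by exact_mod_cast hi
    simp only [Function.comp, zero_add, one_mul]
    rw [one_div, ← div_eq_inv_mul]
    gcongr
    · linarith [hlow i]
    rw [hsum]
    have h := Finset.sum_le_card_nsmul (Finset.range (n i + 1))
      (fun k => r ^ k * (((n i).choose k : ℝ) * pairRatio (m i + (n i - k)) k)) 1 (fun k hk => by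
        have hk' := Nat.lt_succ_iff.1 (Finset.mem_range.1 hk)
        exact mul_le_one₀ (pow_le_one₀ hr.le hr1)
          (mul_nonneg (Nat.cast_nonneg _) (pairRatio_pos _ _).le)
          (choose_mul_pairRatio_le_one (by omega)))
    refine h.trans ?_
    simp only [Finset.card_range, nsmul_eq_mul, mul_one]
    push_cast
    linarith [(m i).cast_nonneg (α := ℝ)]

end Laplace

/-! ### The annealed measure -/

instance : MeasurableSingletonClass ℤˣ where
  measurableSet_singleton u := by
    refine ⟨{(u : ℤ)}, measurableSet_singleton _, ?_⟩
    ext v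
    simp [Units.ext_iff]

section Measure

variable {β B : ℝ} {N : ℕ} {d : Fin N → ℕ}

theorem abs_totalSpin_le (σ : Spins N) : |totalSpin σ| ≤ N := by
  calc |totalSpin σ| ≤ ∑ i : Fin N, |spin σ i| := Finset.abs_sum_le_sum_abs _ _
    _ = N := by
      have : ∀ i, |spin σ i| = 1 := fun i => by
        rcases Int.units_eq_one_or (σ i) with h | h <;> simp [spin, h]
      simp [this]

theorem graphMean_partitionFunction_pos (hev : Even (∑ i, d i)) :
    0 < graphMean (partitionFunction β B : Pairing d → ℝ) := by
  have := nonempty_pairing hev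
  refine div_pos (Finset.sum_pos (fun π _ => ?_) Finset.univ_nonempty)
    (by exact_mod_cast Fintype.card_pos)
  exact Finset.sum_pos (fun σ _ => boltzmannWeight_pos β B σ π) Finset.univ_nonempty

theorem annealedProb_eq (σ : Spins N) : annealedProb β B d σ = Real.exp (B * totalSpin σ) *
    graphMean (fun π : Pairing d => Real.exp (β * edgeSum π σ)) /
      graphMean (partitionFunction β B : Pairing d → ℝ) := by
  unfold annealedProb graphMean boltzmannWeight
  congr 1
  rw [mul_div_assoc', Finset.mul_sum]
  congr 1
  exact Finset.sum_congr rfl fun π _ => by rw [← Real.exp_add, add_comm]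

theorem annealedProb_nonneg (σ : Spins N) : 0 ≤ annealedProb β B d σ :=
  div_nonneg (div_nonneg (Finset.sum_nonneg fun π _ => (boltzmannWeight_pos β B σ π).le)
    (Nat.cast_nonneg _)) (div_nonneg (Finset.sum_nonneg fun π _ =>
      Finset.sum_nonneg fun σ _ => (boltzmannWeight_pos β B σ π).le) (Nat.cast_nonneg _))

theorem sum_annealedProb (hev : Even (∑ i, d i)) : ∑ σ, annealedProb β B d σ = 1 := by
  simp only [annealedProb_eq]
  rw [← Finset.sum_div, ← graphMean_partitionFunction,
    div_self (graphMean_partitionFunction_pos hev).ne']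

/-- Exponential tilting shifts the field, so the normalized cumulant generating function is a
difference of pressures. -/
theorem sum_annealedProb_mul_exp (x : ℝ) :
    ∑ σ, annealedProb β B d σ * Real.exp (x * totalSpin σ) =
      graphMean (partitionFunction β (B + x) : Pairing d → ℝ) /
        graphMean (partitionFunction β B : Pairing d → ℝ) := by
  rw [graphMean_partitionFunction β (B + x), Finset.sum_div]
  refine Finset.sum_congr rfl fun σ _ => ?_
  rw [annealedProb_eq, add_mul, Real.exp_add]
  ring

theorem complexLaplace_annealedProb (z : ℂ) :
    complexLaplace (annealedProb β B d) totalSpin z =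
      (∑ σ : Spins N, Complex.exp ((B + z) * totalSpin σ) *
        (graphMean (fun π : Pairing d => Real.exp (β * edgeSum π σ)) : ℝ)) /
        (graphMean (partitionFunction β B : Pairing d → ℝ) : ℝ) := by
  rw [complexLaplace, Finset.sum_div]
  refine Finset.sum_congr rfl fun σ _ => ?_
  rw [annealedProb_eq, add_mul, Complex.exp_add]
  push_cast
  ring

theorem integral_annealedMeasure {E : Type*} [NormedAddCommGroup E] [NormedSpace ℝ E]
    [CompleteSpace E] (f : Spins N → E) :
    ∫ σ, f σ ∂annealedMeasure β B d = ∑ σ, annealedProb β B d σ • f σ := by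
  rw [annealedMeasure, integral_finsetSum_measure fun σ _ => ?_]
  · refine Finset.sum_congr rfl fun σ _ => ?_
    rw [integral_smul_measure, integral_dirac, ENNReal.toReal_ofReal (annealedProb_nonneg σ)]
  · exact (integrable_dirac (by simp)).smul_measure ENNReal.ofReal_ne_top

end Measure

/-! ### Smoothness of the explicit part of the pressure -/

theorem contDiff_lambdaPlus (β : ℝ) : ContDiff ℝ 2 (lambdaPlus β) := by
  unfold lambdaPlus
  have h : ContDiff ℝ 2 fun B : ℝ => √(Real.sinh B ^ 2 + Real.exp (-4 * β)) :=
    ContDiff.sqrt (by fun_prop) fun B => by positivity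
  fun_prop

theorem contDiff_log_lambdaPlus (β : ℝ) : ContDiff ℝ 2 fun b => Real.log (lambdaPlus β b) :=
  (contDiff_lambdaPlus β).log fun b => (lambdaPlus_pos β b).ne'

theorem contDiff_log_APlus (β : ℝ) : ContDiff ℝ 2 fun b => Real.log (APlus β b) := by
  refine ContDiff.log ?_ fun b => (APlus_pos β b).ne'
  have h := contDiff_lambdaPlus β
  have h0 := lambdaPlus_pos β
  unfold APlus
  refine ContDiff.div (by fun_prop) (by fun_prop) fun b => ?_
  have := h0 b
  positivity

/-! ### The rate -/

section Sequence

variable {p β : ℝ} {d : (N : ℕ) → Fin N → ℕ}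

theorem tendsto_size (d : (N : ℕ) → Fin N → ℕ) :
    Tendsto (fun N : EvenSize d => N.1) (comap (fun N : EvenSize d => N.1) atTop) atTop :=
  tendsto_comap

/-- Were the total degree odd for all large sizes, `⌊pN⌋` would have to change by an odd amount,
hence grow by at least one, at each step; this contradicts `p < 1`. -/
theorem comap_size_neBot (hp0 : 0 < p) (hp1 : p < 1) (hd : ∀ N i, d N i = 1 ∨ d N i = 2)
    (hcard : ∀ N, (Finset.univ.filter fun i => d N i = 2).card = ⌊p * (N : ℝ)⌋₊) :
    (comap (fun N : EvenSize d => N.1) atTop).NeBot := by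
  have hdeg : ∀ N, ∑ i, d N i = N + ⌊p * (N : ℝ)⌋₊ := by
    intro N
    obtain ⟨h1, h2⟩ := degree_counts (hd N)
    rw [hcard] at h1 h2
    omega
  rw [comap_neBot_iff]
  intro t ht
  obtain ⟨N₀, hN₀⟩ := mem_atTop_sets.1 ht
  by_contra hcon
  push Not at hcon
  have hodd : ∀ N, N₀ ≤ N → ¬ Even (N + ⌊p * (N : ℝ)⌋₊) := fun N hN he =>
    hcon ⟨N, by rw [hdeg]; exact he⟩ (hN₀ N hN)
  have hmono : ∀ N : ℕ, ⌊p * (N : ℝ)⌋₊ ≤ ⌊p * ((N + 1 : ℕ) : ℝ)⌋₊ := fun N =>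
    Nat.floor_le_floor (by push_cast; nlinarith)
  have hgrow : ∀ k : ℕ, ⌊p * (N₀ : ℝ)⌋₊ + k ≤ ⌊p * ((N₀ + k : ℕ) : ℝ)⌋₊ := by
    intro k
    induction k with
    | zero => simp
    | succ k ih =>
      have h1 := hodd (N₀ + k) (by omega)
      have h2 := hodd (N₀ + k + 1) (by omega)
      have h3 := hmono (N₀ + k)
      rw [← add_assoc N₀ k 1]
      rw [Nat.even_iff] at h1 h2
      omega
  obtain ⟨k, hk⟩ := exists_nat_gt (1 / (1 - p))
  have h1 : ((⌊p * (N₀ : ℝ)⌋₊ + k : ℕ) : ℝ) ≤ p * ((N₀ + k : ℕ) : ℝ) :=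
    (Nat.cast_le.2 (hgrow k)).trans (Nat.floor_le (by positivity))
  have h2 := Nat.lt_floor_add_one (p * (N₀ : ℝ))
  rw [div_lt_iff₀ (by linarith)] at hk
  push_cast at h1
  nlinarith

theorem tendsto_card_two_div (hp0 : 0 < p)
    (hcard : ∀ N, (Finset.univ.filter fun i => d N i = 2).card = ⌊p * (N : ℝ)⌋₊) :
    Tendsto (fun N : EvenSize d =>
      ((Finset.univ.filter fun i => d N.1 i = 2).card : ℝ) / (N.1 : ℝ))
      (comap (fun N : EvenSize d => N.1) atTop) (𝓝 p) := by
  simp only [hcard]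
  exact (tendsto_nat_floor_mul_div_atTop hp0.le).comp
    (tendsto_natCast_atTop_atTop.comp (tendsto_size d))

theorem size_eq (hd : ∀ N i, d N i = 1 ∨ d N i = 2) (N : EvenSize d) :
    2 * ((Finset.univ.filter fun i => d N.1 i = 1).card / 2) +
      (Finset.univ.filter fun i => d N.1 i = 2).card = N.1 := by
  obtain ⟨h1, h2⟩ := degree_counts (hd N.1)
  have h3 := N.2
  rw [h2, Nat.even_iff] at h3
  omega

theorem tendsto_lineRate (hp0 : 0 < p) (hp1 : p < 1) (hβ : 0 < β)
    (hd : ∀ N i, d N i = 1 ∨ d N i = 2)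
    (hcard : ∀ N, (Finset.univ.filter fun i => d N i = 2).card = ⌊p * (N : ℝ)⌋₊) (b : ℝ) :
    Tendsto
      (fun N : EvenSize d => (1 / (N.1 : ℝ)) *
        Real.log (graphMean (partitionFunction β b : Pairing (d N.1) → ℝ) /
          (lambdaPlus β b ^ N.1 *
            APlus β b ^ ((Finset.univ.filter fun i => d N.1 i = 1).card / 2))))
      (comap (fun N : EvenSize d => N.1) atTop) (𝓝 (lineRate p β b)) := by
  have hr : 0 < ratioLambda β b := div_pos (lambdaMinus_pos b hβ) (lambdaPlus_pos β b)
  have hr1 : ratioLambda β b ≤ 1 :=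
    div_le_one_of_le₀ (lambdaMinus_lt_lambdaPlus b).le (lambdaPlus_pos β b).le
  have heq := fun N : EvenSize d => graphMean_partitionFunction_eq_lineSum hβ b (hd N.1) N.2
  simp only [heq]
  have hsize := tendsto_size d
  have htwo := tendsto_card_two_div hp0 hcard
  simp only [← size_eq hd] at hsize htwo
  rw [lineRate]
  split_ifs with hb
  · have hx : ratioA β b * ratioLambda β b ^ 2 = 0 := by
      rw [hb, ratioA, AMinus_zero hβ, zero_div, zero_mul]
    rw [hx]
    have := tendsto_log_lineSum_zero hr hr1 hsize
    simpa only [size_eq hd] using this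
  · have hx : 0 < ratioA β b * ratioLambda β b ^ 2 :=
      mul_pos (div_pos (AMinus_pos b hβ hb) (APlus_pos β b)) (pow_pos hr 2)
    have := tendsto_log_lineSum hx hr hsize htwo
    rw [maxRate_eq hp0 hp1] at this
    simp only [termRate_eq_H] at this
    simpa only [size_eq hd] using this

/-- The limiting annealed pressure. -/
noncomputable def pressure (p β b : ℝ) : ℝ :=
  Real.log (lambdaPlus β b) + (1 - p) / 2 * Real.log (APlus β b) + lineRate p β b

theorem tendsto_pressure (hp0 : 0 < p) (hp1 : p < 1) (hβ : 0 < β)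
    (hd : ∀ N i, d N i = 1 ∨ d N i = 2)
    (hcard : ∀ N, (Finset.univ.filter fun i => d N i = 2).card = ⌊p * (N : ℝ)⌋₊) (b : ℝ) :
    Tendsto (fun N : EvenSize d => (1 / (N.1 : ℝ)) *
        Real.log (graphMean (partitionFunction β b : Pairing (d N.1) → ℝ)))
      (comap (fun N : EvenSize d => N.1) atTop) (𝓝 (pressure p β b)) := by
  have h1 := tendsto_lineRate hp0 hp1 hβ hd hcard b
  have h2 := ((tendsto_card_two_div hp0 hcard).const_sub 1).div_const 2
  refine ((h2.mul_const (Real.log (APlus β b))).const_add (Real.log (lambdaPlus β b))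
    |>.add h1).congr' ?_
  filter_upwards [(tendsto_size d).eventually_gt_atTop 0] with N hN
  have hN' : (0 : ℝ) < N.1 := by exact_mod_cast hN
  have hZ := graphMean_partitionFunction_pos (β := β) (B := b) N.2
  have hl := lambdaPlus_pos β b
  have hA := APlus_pos β b
  rw [Real.log_div hZ.ne' (by positivity), Real.log_mul (by positivity) (by positivity),
    Real.log_pow, Real.log_pow]
  have hs : (N.1 : ℝ) = 2 * (((Finset.univ.filter fun i => d N.1 i = 1).card / 2 : ℕ) : ℝ) +
      ((Finset.univ.filter fun i => d N.1 i = 2).card : ℝ) := by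
    exact_mod_cast (size_eq hd N).symm
  generalize (((Finset.univ.filter fun i => d N.1 i = 1).card / 2 : ℕ) : ℝ) = m at *
  generalize ((Finset.univ.filter fun i => d N.1 i = 2).card : ℝ) = n at *
  field_simp
  rw [hs]
  ring

end Sequence

end AnnealedCM

open AnnealedCM

/-! ### Assembly of the limit theorem. -/

theorem mainTheorem3 (p β : ℝ) (hp0 : 0 < p) (hp1 : p < 1) (hβ : 0 < β) (B : ℝ)
    (d : (N : ℕ) → Fin N → ℕ)
    (hd : ∀ N i, d N i = 1 ∨ d N i = 2)
    (hcard : ∀ N, (Finset.univ.filter fun i => d N i = 2).card = ⌊p * (N : ℝ)⌋₊) :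
    (∀ b : ℝ, Tendsto
      (fun N : EvenSize d => (1 / (N.1 : ℝ)) *
        Real.log (graphMean (partitionFunction β b : Pairing (d N.1) → ℝ) /
          (lambdaPlus β b ^ N.1 *
            APlus β b ^ ((Finset.univ.filter fun i => d N.1 i = 1).card / 2))))
      (comap (fun N : EvenSize d => N.1) atTop) (𝓝 (lineRate p β b))) ∧
    ContDiffAt ℝ 2 (lineRate p β) B ∧
    0 ≤ sigmaSq p β B ∧
    TendstoInDistribution
      (fun (N : EvenSize d) (σ : Spins N.1) =>
        (totalSpin σ - ∫ τ, totalSpin τ ∂(annealedMeasure β B (d N.1))) / Real.sqrt (N.1 : ℝ))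
      (comap (fun N : EvenSize d => N.1) atTop)
      (fun x : ℝ => x)
      (fun N : EvenSize d => annealedMeasure β B (d N.1))
      (gaussianReal 0 (sigmaSq p β B).toNNReal) := by
  have hNe := comap_size_neBot hp0 hp1 hd hcard
  obtain ⟨δ, hδ, hzero⟩ := exists_forall_annealedPartition_ne_zero hβ B
  have hlim := tendsto_pressure hp0 hp1 hβ hd hcard
  have hsize := tendsto_natCast_atTop_atTop (R := ℝ) |>.comp (tendsto_size d)
  obtain ⟨hana, hnonneg, hchar⟩ := tendsto_charFun_of_zeroFree
    (w := fun N : EvenSize d => annealedProb β B (d N.1))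
    (S := fun N : EvenSize d => totalSpin) (n := fun N : EvenSize d => (N.1 : ℝ)) hsize hδ
    (fun N σ => annealedProb_nonneg σ) (fun N => sum_annealedProb N.2)
    (fun N σ => abs_totalSpin_le σ)
    (fun N z hz => by
      rw [complexLaplace_annealedProb]
      refine div_ne_zero (hzero N.1 (d N.1) (hd N.1) N.2 _ (by simpa using hz)) ?_
      exact_mod_cast (graphMean_partitionFunction_pos N.2).ne')
    (q := fun x => pressure p β (B + x) - pressure p β B)
    (fun x _ => by
      refine ((hlim (B + x)).sub (hlim B)).congr fun N => ?_
      rw [sum_annealedProb_mul_exp, Real.log_div (graphMean_partitionFunction_pos N.2).ne'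
        (graphMean_partitionFunction_pos N.2).ne', mul_sub])
  have hpress : ContDiffAt ℝ 2 (pressure p β) B := by
    have h1 : ContDiffAt ℝ 2 (fun x => pressure p β (B + x) - pressure p β B) (B - B) := by
      rw [sub_self]; exact hana.contDiffAt
    have h2 : ContDiffAt ℝ 2 (fun b : ℝ => b - B) B := by fun_prop
    have h3 := (ContDiffAt.comp (f := fun b : ℝ => b - B) B h1 h2).add (contDiffAt_const (c := pressure p β B))
    refine h3.congr_of_eventuallyEq (Eventually.of_forall fun b => ?_)
    simp
  have hL := (contDiff_log_lambdaPlus β).contDiffAt (x := B)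
  have hA := (contDiff_log_APlus β).contDiffAt (x := B)
  have hA' : ContDiffAt ℝ 2 (fun b => (1 - p) / 2 * Real.log (APlus β b)) B :=
    contDiffAt_const.mul hA
  -- `lineRate` is the pressure minus explicit terms: it inherits the regularity that the zero-free
  -- disc gives the pressure.
  have hline : ContDiffAt ℝ 2 (lineRate p β) B := by
    refine ((hpress.sub hL).sub hA').congr_of_eventuallyEq (Eventually.of_forall fun b => ?_)
    simp only [pressure]
    ring
  have hsig : iteratedDeriv 2 (fun x => pressure p β (B + x) - pressure p β B) 0 =
      sigmaSq p β B := by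
    have hc : ContDiffAt ℝ 2 (fun x => pressure p β (B + x)) 0 := by
      refine ContDiffAt.comp 0 (g := pressure p β) (by simpa using hpress) (by fun_prop)
    rw [iteratedDeriv_fun_sub (n := 2) hc contDiffAt_const, iteratedDeriv_comp_const_add]
    simp only [iteratedDeriv_const, add_zero]
    rw [show pressure p β = fun b => Real.log (lambdaPlus β b) +
      (1 - p) / 2 * Real.log (APlus β b) + lineRate p β b from rfl,
      iteratedDeriv_fun_add (n := 2) (hL.add hA') hline, iteratedDeriv_fun_add (n := 2) hL hA',
      iteratedDeriv_const_mul_field, sigmaSq]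
    simp
  rw [hsig] at hnonneg hchar
  refine ⟨tendsto_lineRate hp0 hp1 hβ hd hcard, hline, hnonneg, ?_⟩
  refine ⟨fun N => (measurable_of_finite _).aemeasurable, by fun_prop, ?_⟩
  -- Passing to sequences of sizes allows Lévy's continuity theorem to be applied.
  refine tendsto_of_seq_tendsto fun u hu => ?_
  refine ProbabilityMeasure.tendsto_of_tendsto_charFun fun θ => ?_
  have h := (hchar θ).comp hu
  have hgauss : charFun ((gaussianReal 0 (sigmaSq p β B).toNNReal).map fun x : ℝ => x) θ =
      Complex.exp (-(sigmaSq p β B * θ ^ 2 / 2 : ℝ)) := by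
    rw [Measure.map_id', charFun_gaussianReal, Real.coe_toNNReal _ hnonneg]
    congr 1
    push_cast
    ring
  simp only [ProbabilityMeasure.coe_mk, hgauss]
  refine h.congr fun k => ?_
  simp only [Function.comp, ProbabilityMeasure.coe_mk, charFun_apply_real]
  rw [integral_map (measurable_of_finite _).aemeasurable (by fun_prop), integral_annealedMeasure,
    integral_annealedMeasure]
  refine Finset.sum_congr rfl fun σ _ => ?_
  rw [Complex.real_smul]
  simp only [smul_eq_mul]
  push_cast
  rfl
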